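/- **Notation.** Let $d\ge 1$, $n,m\ge 0$, $V=(\mathbb{C}^n)^{\otimes d}$ with basis $e_{\mathbf i}=e_{i_1}\otimes\cdots\otimes e_{i_d}$, $\mathbf i\in[n]^d$, and let $\mathrm{GL}(n)^{\times d}$ act on $V$ by $(g_1,\dots,g_d)\cdot v_1\otimes\cdots\otimes v_d=g_1v_1\otimes\cdots\otimes g_dv_d$ and diagonally on each $\bigotimes^k V$. Put $\mathrm{Sym}(v_1\otimes\cdots\otimes v_k)=\sum_{\omega\in S_k}v_{\omega(1)}\otimes\cdots\otimes v_{\omega(k)}$, $\mathrm{Alt}(v_1\otimes\cdots\otimes v_k)=\sum_{\omega\in S_k}\mathrm{sgn}(\omega)\,v_{\omega(1)}\otimes\cdots\otimes v_{\omega(k)}$, $\bigvee V=\bigoplus_{k\ge 0}\mathrm{Sym}(\bigotimes^kV)$ and $\bigwedge V=\bigoplus_{k\ge 0}\mathrm{Alt}(\bigotimes^kV)$. For $W=\bigvee V$ or $\bigwedge V$ let $\mathrm{HWV}_{\boldsymbol\lambda}W$ be the space of those $v\in W$ which have weight $\boldsymbol\lambda$ under the torus of $d$-tuples of invertible diagonal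 matrices and are fixed by all $d$-tuples of upper unitriangular matrices. For $\boldsymbol\alpha=(\alpha^{(1)},\dots,\alpha^{(d)})$ with $|\alpha^{(l)}|=m$, let $A(\boldsymbol\alpha)$ be the set of $d\times m$ tables $T=(t_1,\dots,t_d)$ of positive integers in whose $l$-th row $t_l$ each letter $i$ occurs exactly $\alpha^{(l)}_i$ times ($\mathbb{N}$-tables), and $B(\boldsymbol\alpha)\subseteq A(\boldsymbol\alpha)$ the subset of tables without repeated columns ($(0,1)$-tables). A table is *lattice* if in each prefix of each of its rows there are, for every $i$, at least as many letters $i$ as letters $i+1$; $A^+(\boldsymbol\alpha)$, $B^+(\boldsymbol\alpha)$ are the sets of lattice tables in $A(\boldsymbol\alpha)$, $B(\boldsymbol\alpha)$. Let $A^{\mathrm{lex}}(\boldsymbol\alpha)$ (resp. $B^{\mathrm{lex}}(\boldsymbol\alpha)$) be the set of *lex-tables*, i.e. of the $d$-line notations of the $d$-dimensional hypermatrices $H$ of finite support with entries in $\mathbb{Z}_{\ge0}$ (resp. in $\{0,1\}$) and with marginals (slice sums) $\boldsymbol\alpha$; the $d$-line notation of $H$ is the table in which each column $\mathbf i$ occurs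 exactly $H_{\mathbf i}$ times, the columns being ordered lexicographically. For words $t,s$ of length $m$, $\mathrm{sgn}_t(s)$ is the product over the blocks $\{b_1<\dots<b_k\}$ of $t$ (the sets of positions of a fixed letter) of $\mathrm{sgn}(s(b_1),\dots,s(b_k))$, which is the sign of this sequence if it is a permutation of $[k]$, and $0$ otherwise. For tables, $\mathrm{sgn}_T(S)=\prod_{l}\mathrm{sgn}_{t_l}(s_l)$, $(-1)^T=\prod_l(-1)^{\mathrm{inv}(t_l)}$ with $\mathrm{inv}$ the number of inversions, and $\|T\|$ is the order of the stabilizer of $T$ in $S_m$ acting by permuting columns. For $X\in A(\boldsymbol\lambda)$ with columns $X(1),\dots,X(m)$ put $\bigvee e_X=\mathrm{Sym}(e_{X(1)}\otimes\cdots\otimes e_{X(m)})$ and $\bigwedge e_X=\mathrm{Alt}(e_{X(1)}\otimes\cdots\otimes e_{X(m)})$. For a $d$-tuple $\boldsymbol\lambda$ of partitions of $m$, with conjugate $\boldsymbol\lambda'$, and $T,S\in A(\boldsymbol\lambda')$, let $$\Delta_T=\frac{(-1)^T}{\|T\|}\sum_{X\in A(\boldsymbol\lambda)}\mathrm{sgn}_T(X)\bigvee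 e_X,\qquad \nabla_S=\frac{(-1)^S}{\|S\|}\sum_{Y\in B(\boldsymbol\lambda)}\mathrm{sgn}_S(Y)\bigwedge e_Y .$$ **Theorem.** Let $\boldsymbol\lambda$ be a $d$-tuple of partitions of $m$ with lengths at most $n$. (i) If $d$ is odd, then $$\mathrm{HWV}_{\boldsymbol\lambda}\bigvee(\mathbb{C}^n)^{\otimes d}=\mathrm{span}\{\Delta_T\mid T\in B^+(\boldsymbol\lambda')\},\qquad \mathrm{HWV}_{\boldsymbol\lambda}\bigwedge(\mathbb{C}^n)^{\otimes d}=\mathrm{span}\{\nabla_S\mid S\in A^+(\boldsymbol\lambda')\}.$$ (ii) If $d$ is even, then $$\mathrm{HWV}_{\boldsymbol\lambda}\bigvee(\mathbb{C}^n)^{\otimes d}=\mathrm{span}\{\Delta_T\mid T\in A^+(\boldsymbol\lambda')\},\qquad \mathrm{HWV}_{\boldsymbol\lambda}\bigwedge(\mathbb{C}^n)^{\otimes d}=\mathrm{span}\{\nabla_S\mid S\in B^+(\boldsymbol\lambda')\}.$$ (iii) Statements (i) and (ii) remain true when $A^+$ and $B^+$ are replaced by $A^{\mathrm{lex}}$ and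 $B^{\mathrm{lex}}$, respectively. -/

import Mathlib

open scoped TensorProduct DirectSum

noncomputable section

namespace TensorHWV

/-! ### Words and tables

Letters are indexed from `0`: the letter `i` here is the letter `i + 1` of the usual convention, and
likewise the parts of a partition are `rowLen 0 ≥ rowLen 1 ≥ …` -/

/-- A word of length `m`. -/
abbrev Word (m : ℕ) : Type := Fin m → ℕ

/-- A `d × m` table; `T l` is its `l`-th row and `fun l => T l j` is its `j`-th column. -/
abbrev Table (d m : ℕ) : Type := Fin d → Word m

/-- The word `w` has weight `α`: each letter `i` occurs exactly `α i` times. -/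
def Word.HasWeight {m : ℕ} (w : Word m) (α : ℕ → ℕ) : Prop :=
  ∀ i : ℕ, (Finset.univ.filter fun j => w j = i).card = α i

/-- Every prefix of `w` has at least as many letters `i` as letters `i + 1`. -/
def Word.IsLattice {m : ℕ} (w : Word m) : Prop :=
  ∀ k i : ℕ, (Finset.univ.filter fun j : Fin m => (j : ℕ) < k ∧ w j = i + 1).card ≤
    (Finset.univ.filter fun j : Fin m => (j : ℕ) < k ∧ w j = i).card

/-- The `j`-th column of a table. -/
def Table.col {d m : ℕ} (T : Table d m) (j : Fin m) : Fin d → ℕ := fun l => T l j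

/-- The set `A(α)` of tables of weight `α = (α⁽¹⁾, …, α⁽ᵈ⁾)`, also called `ℕ`-tables. -/
def tablesA (d m : ℕ) (α : Fin d → ℕ → ℕ) : Set (Table d m) :=
  {T | ∀ l, (T l).HasWeight (α l)}

/-- The set `B(α)` of tables of weight `α` without repeated columns, also called `(0,1)`-tables. -/
def tablesB (d m : ℕ) (α : Fin d → ℕ → ℕ) : Set (Table d m) :=
  {T ∈ tablesA d m α | Function.Injective T.col}

/-- The lattice tables in `A(α)`. -/
def latticeA (d m : ℕ) (α : Fin d → ℕ → ℕ) : Set (Table d m) :=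
  {T ∈ tablesA d m α | ∀ l, (T l).IsLattice}

/-- The lattice tables in `B(α)`. -/
def latticeB (d m : ℕ) (α : Fin d → ℕ → ℕ) : Set (Table d m) :=
  {T ∈ tablesB d m α | ∀ l, (T l).IsLattice}

/-! ### Hypermatrices and lex-tables -/

/-- A `d`-dimensional `ℕ`-hypermatrix of finite support. -/
abbrev Hypermatrix (d : ℕ) : Type := (Fin d → ℕ) →₀ ℕ

/-- The `j`-th marginal of `H` in direction `l`, i.e. the sum of the entries of the `j`-th slice. -/
def Hypermatrix.marginal {d : ℕ} (H : Hypermatrix d) (l : Fin d) (j : ℕ) : ℕ :=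
  H.sum fun i c => if i l = j then c else 0

/-- The set of `ℕ`-hypermatrices with marginals `α`. -/
def hypermatricesN (d : ℕ) (α : Fin d → ℕ → ℕ) : Set (Hypermatrix d) :=
  {H | ∀ l j, H.marginal l j = α l j}

/-- The set of `(0,1)`-hypermatrices with marginals `α`. -/
def hypermatrices01 (d : ℕ) (α : Fin d → ℕ → ℕ) : Set (Hypermatrix d) :=
  {H ∈ hypermatricesN d α | ∀ i, H i ≤ 1}

/-- `T` is the `d`-line notation of `H`: each column `i` occurs exactly `H i` times, and the columns
are in (weakly increasing) lexicographic order. -/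
def IsDLine {d m : ℕ} (H : Hypermatrix d) (T : Table d m) : Prop :=
  (∀ i : Fin d → ℕ, (Finset.univ.filter fun j => T.col j = i).card = H i) ∧
    Monotone fun j => toLex (T.col j)

/-- The lex-tables `A^lex(α)`: the `d`-line notations of `ℕ`-hypermatrices with marginals `α`. -/
def lexA (d m : ℕ) (α : Fin d → ℕ → ℕ) : Set (Table d m) :=
  {T | ∃ H ∈ hypermatricesN d α, IsDLine H T}

/-- The lex-tables `B^lex(α)`: the `d`-line notations of `(0,1)`-hypermatrices with marginals
`α`. -/
def lexB (d m : ℕ) (α : Fin d → ℕ → ℕ) : Set (Table d m) :=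
  {T | ∃ H ∈ hypermatrices01 d α, IsDLine H T}

/-! ### Signs -/

/-- The sign of a sequence `(a₁, …, a_k)`: the sign of `a` if `a` is a permutation of the `k` letters
`0, …, k - 1`, and `0` otherwise. (At most one term of the sum is nonzero.) -/
def seqSign {k : ℕ} (a : Fin k → ℕ) : ℤ :=
  ∑ π : Equiv.Perm (Fin k), if ∀ i, (π i : ℕ) = a i then (Equiv.Perm.sign π : ℤ) else 0

/-- The block of the letter `i` in `t`, i.e. the set of positions of `i`. -/
def Word.block {m : ℕ} (t : Word m) (i : ℕ) : Finset (Fin m) :=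
  Finset.univ.filter fun j => t j = i

/-- The signature `sgn_t(s)`: the product, over the blocks `{b₁ < … < b_k}` of `t`, of the signs of
`(s(b₁), …, s(b_k))`. -/
def wordSgn {m : ℕ} (t s : Word m) : ℤ :=
  ∏ i ∈ Finset.univ.image t, seqSign fun r => s ((t.block i).orderEmbOfFin rfl r)

/-- `sgn_T(S)`, the product of `sgn` over the rows. -/
def tableSgn {d m : ℕ} (T S : Table d m) : ℤ := ∏ l, wordSgn (T l) (S l)

/-- The number of inversions of a word. -/
def Word.inv {m : ℕ} (w : Word m) : ℕ :=
  (Finset.univ.filter fun p : Fin m × Fin m => p.1 < p.2 ∧ w p.2 < w p.1).card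

/-- The sign `(-1)^T`, which is `±1`. -/
def Table.sign {d m : ℕ} (T : Table d m) : ℤ := ∏ l, (-1) ^ (T l).inv

/-- `‖T‖`, the order of the stabilizer of `T` under permutations of its columns. -/
def Table.stabCard {d m : ℕ} (T : Table d m) : ℕ :=
  Nat.card {π : Equiv.Perm (Fin m) // ∀ j, T.col (π j) = T.col j}

/-! ### Tensors, symmetric and alternating spaces -/

/-- `V = (ℂⁿ)^{⊗ d}`. -/
abbrev V (d n : ℕ) : Type := ⨂[ℂ] _ : Fin d, (Fin n → ℂ)

/-- The tensor algebra `⨁ₖ V^{⊗ k}` as a graded vector space. -/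
abbrev TensorSpace (d n : ℕ) : Type := ⨁ k : ℕ, ⨂[ℂ]^k (V d n)

/-- `Sym(v₁ ⊗ … ⊗ v_k) = ∑_ω v_{ω(1)} ⊗ … ⊗ v_{ω(k)}`. -/
def sym (d n k : ℕ) : ⨂[ℂ]^k (V d n) →ₗ[ℂ] ⨂[ℂ]^k (V d n) :=
  ∑ ω : Equiv.Perm (Fin k), (PiTensorProduct.reindex ℂ (fun _ => V d n) ω⁻¹).toLinearMap

/-- `Alt(v₁ ⊗ … ⊗ v_k) = ∑_ω sgn(ω) v_{ω(1)} ⊗ … ⊗ v_{ω(k)}`. -/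
def alt (d n k : ℕ) : ⨂[ℂ]^k (V d n) →ₗ[ℂ] ⨂[ℂ]^k (V d n) :=
  ∑ ω : Equiv.Perm (Fin k), ((Equiv.Perm.sign ω : ℤ) : ℂ) •
    (PiTensorProduct.reindex ℂ (fun _ => V d n) ω⁻¹).toLinearMap

/-- `⋁ V = ⨁ₖ Sym(V^{⊗ k})`. -/
def symSpace (d n : ℕ) : Submodule ℂ (TensorSpace d n) :=
  LinearMap.range (DirectSum.lmap (sym d n))

/-- `⋀ V = ⨁ₖ Alt(V^{⊗ k})`. -/
def altSpace (d n : ℕ) : Submodule ℂ (TensorSpace d n) :=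
  LinearMap.range (DirectSum.lmap (alt d n))

/-- The action of `GL(n)^{× d}` on `V`:
`g · (v₁ ⊗ … ⊗ v_d) = g₁ v₁ ⊗ … ⊗ g_d v_d`. -/
def actV {d n : ℕ} (g : Fin d → GL (Fin n) ℂ) : V d n →ₗ[ℂ] V d n :=
  PiTensorProduct.map fun l => Matrix.mulVecLin (g l : Matrix (Fin n) (Fin n) ℂ)

/-- The induced (diagonal) action of `GL(n)^{× d}` on `⨁ₖ V^{⊗ k}`. -/
def act {d n : ℕ} (g : Fin d → GL (Fin n) ℂ) : TensorSpace d n →ₗ[ℂ] TensorSpace d n :=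
  DirectSum.lmap fun _ => PiTensorProduct.map fun _ => actV g

/-- Vectors of weight `α` in a subspace `W` of `⨁ₖ V^{⊗ k}`: those `v` with `t · v = t^α v` for
each `t` in the torus of `d`-tuples of diagonal matrices. -/
def WV {d n : ℕ} (α : Fin d → ℕ → ℕ) (W : Submodule ℂ (TensorSpace d n)) :
    Submodule ℂ (TensorSpace d n) where
  carrier := {v | v ∈ W ∧ ∀ t : Fin d → GL (Fin n) ℂ,
    (∀ l, (t l : Matrix (Fin n) (Fin n) ℂ).IsDiag) →
      act t v = (∏ l, ∏ i : Fin n, (t l : Matrix (Fin n) (Fin n) ℂ) i i ^ α l i) • v}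
  add_mem' := fun ha hb => ⟨W.add_mem ha.1 hb.1, fun t ht => by
    rw [map_add, ha.2 t ht, hb.2 t ht, smul_add]⟩
  zero_mem' := ⟨W.zero_mem, fun t _ => by rw [map_zero, smul_zero]⟩
  smul_mem' := fun c _ ha => ⟨W.smul_mem c ha.1, fun t ht => by
    rw [map_smul, ha.2 t ht, smul_comm]⟩

/-- The highest weight space of weight `α` in `W`: the vectors of weight `α` in `W` that are fixed
by all `d`-tuples of upper unitriangular matrices. -/
def HWV {d n : ℕ} (α : Fin d → ℕ → ℕ) (W : Submodule ℂ (TensorSpace d n)) :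
    Submodule ℂ (TensorSpace d n) where
  carrier := {v | v ∈ WV α W ∧ ∀ u : Fin d → GL (Fin n) ℂ,
    (∀ l, (∀ i, (u l : Matrix (Fin n) (Fin n) ℂ) i i = 1) ∧
      ∀ i j, j < i → (u l : Matrix (Fin n) (Fin n) ℂ) i j = 0) → act u v = v}
  add_mem' := fun ha hb => ⟨Submodule.add_mem _ ha.1 hb.1, fun u hu => by
    rw [map_add, ha.2 u hu, hb.2 u hu]⟩
  zero_mem' := ⟨Submodule.zero_mem _, fun u _ => map_zero _⟩
  smul_mem' := fun c _ ha => ⟨Submodule.smul_mem _ c ha.1, fun u hu => by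
    rw [map_smul, ha.2 u hu]⟩

/-! ### The vectors `Δ_T` and `∇_S` -/

/-- The basis vector `e_{i₁} ⊗ … ⊗ e_{i_d}` of `V`. -/
def basisVec {d n : ℕ} (i : Fin d → Fin n) : V d n :=
  PiTensorProduct.tprod ℂ fun l => (Pi.single (i l) 1 : Fin n → ℂ)

/-- `⨂ e_X = e_{X(1)} ⊗ … ⊗ e_{X(m)}`, for a table `X` with entries in `[n]`. -/
def tensorOf {d n m : ℕ} (X : Fin d → Fin m → Fin n) : ⨂[ℂ]^m (V d n) :=
  PiTensorProduct.tprod ℂ fun j => basisVec fun l => X l j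

/-- A table with entries in `[n]` as a table. -/
def toTable {d n m : ℕ} (X : Fin d → Fin m → Fin n) : Table d m := fun l j => (X l j : ℕ)

/-- The weight given by a tuple of partitions. -/
def weight {d : ℕ} (lam : Fin d → YoungDiagram) : Fin d → ℕ → ℕ := fun l i => (lam l).rowLen i

/-- The conjugate tuple of partitions. -/
def conj {d : ℕ} (lam : Fin d → YoungDiagram) : Fin d → YoungDiagram := fun l => (lam l).transpose

open Classical in
/-- `Δ_T = ((-1)^T / ‖T‖) ∑_{X ∈ A(λ)} sgn_T(X) ⋁ e_X`, an element of degree `m`, where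
`⋁ e_X = Sym(⨂ e_X)`. When the partitions have length at most `n`, all tables in `A(λ)` have
entries in `[n]`. -/
def Delta {d m : ℕ} (n : ℕ) (lam : Fin d → YoungDiagram) (T : Table d m) : TensorSpace d n :=
  DirectSum.lof ℂ ℕ (fun k => ⨂[ℂ]^k (V d n)) m
    (((T.sign : ℂ) / (T.stabCard : ℂ)) •
      ∑ X : Fin d → Fin m → Fin n with toTable X ∈ tablesA d m (weight lam),
        (tableSgn T (toTable X) : ℂ) • sym d n m (tensorOf X))

open Classical in
/-- `∇_S = ((-1)^S / ‖S‖) ∑_{Y ∈ B(λ)} sgn_S(Y) ⋀ e_Y`, an element of degree `m`, where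
`⋀ e_Y = Alt(⨂ e_Y)`. -/
def Nabla {d m : ℕ} (n : ℕ) (lam : Fin d → YoungDiagram) (S : Table d m) : TensorSpace d n :=
  DirectSum.lof ℂ ℕ (fun k => ⨂[ℂ]^k (V d n)) m
    (((S.sign : ℂ) / (S.stabCard : ℂ)) •
      ∑ Y : Fin d → Fin m → Fin n with toTable Y ∈ tablesB d m (weight lam),
        (tableSgn S (toTable Y) : ℂ) • alt d n m (tensorOf Y))

end TensorHWV

end

open scoped TensorProduct DirectSum

noncomputable section

namespace TensorHWV

/-! ### Signs of sequences and words -/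

/-! In the basis `tensorOf X`, a vector of V^{⊗m} is a function on tables with entries in [n].
Freezing all rows but one turns a highest weight vector into a function on words that has weight
λ^(l) and is killed by the raising operators (`isHW_slice`). The core of the theorem is therefore
the case of a single row, (ℂⁿ)^{⊗m}.

For one row, every word t of weight λ' gives the highest weight vector with coordinates x ↦
sgn_t(x): a copy of e_1 ∧ … ∧ e_k placed on each block of t. Those with t lattice already span
(`IsHW.mem_span`). Indeed a nonzero highest weight vector has a nonzero coordinate at some lattice
word (`IsHW.exists_lattice`), and conjugation of lattice words, the transposition of standard
tableaux, makes the matrix of signs sgn_t(s') at lattice words unitriangular for the lexicographic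
order (`wordSgn_conj`, `toLex_le_of_wordSgn_conj_ne_zero`). So leading coordinates can be eliminated
one at a time.

A function of several words whose slices in each variable lie in given spans is a combination of
products (`mem_span_prod`), so the vectors `tableVec n T` with T lattice span the highest weight
vectors of V^{⊗m}.

Finally, symmetric and alternating spaces are images of ∑ χ(ω) ω, which commutes with the group and
is m! times a projection. It sends `tableVec n T` to a nonzero multiple of Δ_T or ∇_T. Permuting the
columns of T changes the image only by a sign, so columns may be sorted: this is the lex version. If
T has two equal columns, exchanging them in the summation tables multiplies the image by
χ(transposition)·(-1)^d. When this is -1 (d odd for Sym, d even for Alt) the image vanishes, and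
only tables without repeated columns remain. -/

theorem seqSign_comp {k : ℕ} (a : Fin k → ℕ) (σ : Equiv.Perm (Fin k)) :
    seqSign (a ∘ σ) = (Equiv.Perm.sign σ : ℤ) * seqSign a := by
  unfold seqSign
  rw [← Equiv.sum_comp (Equiv.mulRight σ), Finset.mul_sum]
  refine Finset.sum_congr rfl fun ρ _ => ?_
  have : (∀ i, (((Equiv.mulRight σ) ρ) i : ℕ) = (a ∘ σ) i) ↔ ∀ i, (ρ i : ℕ) = a i :=
    ⟨fun h i => by simpa using h (σ⁻¹ i), fun h i => by simpa using h (σ i)⟩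
  by_cases h : ∀ i, (ρ i : ℕ) = a i
  · rw [if_pos (this.2 h), if_pos h]
    simp [mul_comm]
  · rw [if_neg (mt this.1 h), if_neg h, mul_zero]

theorem exists_perm_of_seqSign_ne_zero {k : ℕ} {a : Fin k → ℕ} (h : seqSign a ≠ 0) :
    ∃ π : Equiv.Perm (Fin k), ∀ i, (π i : ℕ) = a i := by
  by_contra hn
  push Not at hn
  refine h (Finset.sum_eq_zero fun π _ => if_neg fun hπ => ?_)
  obtain ⟨i, hi⟩ := hn π
  exact hi (hπ i)

theorem seqSign_val (k : ℕ) : seqSign (fun i : Fin k => (i : ℕ)) = 1 := by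
  unfold seqSign
  rw [Finset.sum_eq_single 1]
  · simp
  · intro π _ hπ
    refine if_neg fun h => hπ ?_
    ext i
    simpa using h i
  · simp

/-- The factor of `wordSgn t s` at the block of the letter `i`. -/
def blockSgn {m : ℕ} (t s : Word m) (i : ℕ) : ℤ :=
  seqSign fun r => s ((t.block i).orderEmbOfFin rfl r)

theorem wordSgn_eq_prod_blockSgn {m : ℕ} (t s : Word m) :
    wordSgn t s = ∏ i ∈ Finset.univ.image t, blockSgn t s i := rfl

theorem Word.mem_block {m : ℕ} {t : Word m} {i : ℕ} {j : Fin m} : j ∈ t.block i ↔ t j = i := by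
  simp [Word.block]

theorem seqSign_orderEmbOfFin_cast {m k : ℕ} (b : Finset (Fin m)) (h : b.card = k) (x : Word m) :
    seqSign (fun r => x (b.orderEmbOfFin rfl r)) = seqSign fun r => x (b.orderEmbOfFin h r) := by
  subst h
  rfl

theorem exists_unit_seqSign_comp_perm {m : ℕ} (π : Equiv.Perm (Fin m)) {b b' : Finset (Fin m)}
    (h : ∀ j, j ∈ b' ↔ π j ∈ b) :
    ∃ ε : ℤˣ, ∀ x : Word m, seqSign (fun r => x (π (b'.orderEmbOfFin rfl r))) =
      (ε : ℤ) * seqSign fun r => x (b.orderEmbOfFin rfl r) := by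
  have hc : b'.card = b.card := Finset.card_bij (fun j _ => π j) (fun j hj => (h j).1 hj)
    (fun _ _ _ _ e => π.injective e) fun j hj => ⟨π⁻¹ j, (h _).2 (by simpa using hj), by simp⟩
  let e' := b'.orderIsoOfFin hc
  let e := b.orderIsoOfFin rfl
  let σ : Equiv.Perm (Fin b.card) :=
    (e'.toEquiv.trans (π.subtypeEquiv h)).trans e.symm.toEquiv
  refine ⟨Equiv.Perm.sign σ, fun x => ?_⟩
  rw [seqSign_orderEmbOfFin_cast b' hc fun j => x (π j), ← seqSign_comp]
  congr 1
  funext r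
  have : e (σ r) = (π.subtypeEquiv h) (e' r) := by simp [σ]
  have h2 := congrArg Subtype.val this
  simp only [e, e', Equiv.subtypeEquiv_apply, Finset.coe_orderIsoOfFin_apply] at h2
  simp [h2]

/-- The blocks of t ∘ π are the preimages under π of the blocks of t, so only the order in which
each block is read changes. The resulting sign does not depend on x, hence can be pulled out of sums
over x. -/
theorem exists_unit_wordSgn_comp {m : ℕ} (t : Word m) (π : Equiv.Perm (Fin m)) :
    ∃ ε : ℤˣ, ∀ x : Word m, wordSgn (t ∘ π) (x ∘ π) = (ε : ℤ) * wordSgn t x := by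
  have h : ∀ i, ∃ ε : ℤˣ, ∀ x : Word m, blockSgn (t ∘ π) (x ∘ π) i = (ε : ℤ) * blockSgn t x i :=
    fun i => exists_unit_seqSign_comp_perm π fun j => by simp [Word.mem_block]
  choose ε hε using h
  refine ⟨∏ i ∈ Finset.univ.image t, ε i, fun x => ?_⟩
  have himg : Finset.univ.image (t ∘ π) = Finset.univ.image t := by
    rw [← Finset.image_image]; simp
  rw [wordSgn_eq_prod_blockSgn, wordSgn_eq_prod_blockSgn, himg, Units.coe_prod,
    ← Finset.prod_mul_distrib]
  exact Finset.prod_congr rfl fun i _ => hε i x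

theorem wordSgn_comp_swap {m : ℕ} (t x : Word m) {p q : Fin m} (hpq : p ≠ q) (h : t p = t q) :
    wordSgn t (x ∘ Equiv.swap p q) = -wordSgn t x := by
  rw [wordSgn_eq_prod_blockSgn, wordSgn_eq_prod_blockSgn,
    ← Finset.mul_prod_erase _ _ (Finset.mem_image_of_mem t (Finset.mem_univ p)),
    ← Finset.mul_prod_erase _ (blockSgn t x) (Finset.mem_image_of_mem t (Finset.mem_univ p)),
    ← neg_mul]
  congr 1
  · have hp : p ∈ Set.range ((t.block (t p)).orderEmbOfFin rfl) := by
      simp [Word.mem_block]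
    have hq : q ∈ Set.range ((t.block (t p)).orderEmbOfFin rfl) := by
      simp [Word.mem_block, h]
    obtain ⟨a, ha⟩ := hp
    obtain ⟨b, hb⟩ := hq
    have hab : a ≠ b := fun e => hpq (by rw [← ha, ← hb, e])
    have := seqSign_comp (fun r => x ((t.block (t p)).orderEmbOfFin rfl r)) (Equiv.swap a b)
    rw [Equiv.Perm.sign_swap hab] at this
    rw [blockSgn, blockSgn]
    simp only [Units.val_neg, Units.val_one, neg_mul, one_mul] at this
    rw [← this]
    congr 1
    funext r
    simp only [Function.comp]
    rw [(RelEmbedding.injective _).map_swap, ha, hb]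
  · refine Finset.prod_congr rfl fun i hi => ?_
    have hi' : i ≠ t p := (Finset.mem_erase.1 hi).1
    unfold blockSgn
    congr 1
    funext r
    have hr := Word.mem_block.1 ((t.block i).orderEmbOfFin_mem rfl r)
    simp only [Function.comp]
    rw [Equiv.swap_apply_of_ne_of_ne]
    · rintro e; rw [e] at hr; exact hi' hr.symm
    · rintro e; rw [e] at hr; exact hi' (by rw [h, hr])

theorem blockSgn_ne_zero {m : ℕ} {t x : Word m} (h : wordSgn t x ≠ 0) (i : ℕ) :
    blockSgn t x i ≠ 0 := by
  by_cases hi : i ∈ Finset.univ.image t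
  · exact Finset.prod_ne_zero_iff.1 (wordSgn_eq_prod_blockSgn t x ▸ h) i hi
  -- A letter absent from t has an empty block, and the empty sequence has sign 1.
  · have h0 : (t.block i).card = 0 := by
      rw [Finset.card_eq_zero, Finset.eq_empty_iff_forall_notMem]
      intro j hj
      exact hi (Finset.mem_image.2 ⟨j, Finset.mem_univ _, Word.mem_block.1 hj⟩)
    rw [blockSgn, seqSign_orderEmbOfFin_cast _ h0]
    simp [seqSign]

theorem exists_orderEmb_block {m : ℕ} (t : Word m) (p : Fin m) :
    ∃ r, (t.block (t p)).orderEmbOfFin rfl r = p := by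
  have : p ∈ Set.range ((t.block (t p)).orderEmbOfFin rfl) := by simp [Word.mem_block]
  exact this

theorem lt_card_block_of_wordSgn_ne_zero {m : ℕ} {t x : Word m} (h : wordSgn t x ≠ 0)
    (p : Fin m) : x p < (t.block (t p)).card := by
  obtain ⟨π, hπ⟩ := exists_perm_of_seqSign_ne_zero (blockSgn_ne_zero h (t p))
  obtain ⟨r, hr⟩ := exists_orderEmb_block t p
  have := hπ r
  rw [hr] at this
  rw [← this]
  exact (π r).2

theorem eq_of_wordSgn_ne_zero {m : ℕ} {t x : Word m} (h : wordSgn t x ≠ 0)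
    {p q : Fin m} (ht : t p = t q) (hx : x p = x q) : p = q := by
  by_contra hpq
  have h1 := wordSgn_comp_swap t x hpq ht
  have h2 : x ∘ Equiv.swap p q = x := by
    funext j
    rcases eq_or_ne j p with rfl | hj
    · simp [hx]
    rcases eq_or_ne j q with rfl | hj'
    · simp [hx]
    simp [Equiv.swap_apply_of_ne_of_ne hj hj']
  rw [h2] at h1
  omega

theorem exists_of_lt_card_block {m : ℕ} {t x : Word m} (h : wordSgn t x ≠ 0) {i c : ℕ}
    (hc : c < (t.block i).card) : ∃ p, t p = i ∧ x p = c := by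
  obtain ⟨π, hπ⟩ := exists_perm_of_seqSign_ne_zero (blockSgn_ne_zero h i)
  refine ⟨(t.block i).orderEmbOfFin rfl (π⁻¹ ⟨c, hc⟩),
    Word.mem_block.1 ((t.block i).orderEmbOfFin_mem rfl _), ?_⟩
  rw [← hπ]
  simp

/-! ### Prefix counts and conjugate words -/

/-- The number of letters `i` among the first `k` letters of `w`. -/
def Word.count {m : ℕ} (w : Word m) (k i : ℕ) : ℕ :=
  (Finset.univ.filter fun j : Fin m => (j : ℕ) < k ∧ w j = i).card

theorem Word.isLattice_iff {m : ℕ} {w : Word m} :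
    w.IsLattice ↔ ∀ k i, w.count k (i + 1) ≤ w.count k i := Iff.rfl

theorem Word.count_of_le {m k : ℕ} (w : Word m) (h : m ≤ k) (i : ℕ) :
    w.count k i = (w.block i).card := by
  unfold Word.count Word.block
  congr 1
  ext j
  simp only [Finset.mem_filter, Finset.mem_univ, true_and, and_iff_right_iff_imp]
  intro _
  omega

theorem Word.hasWeight_iff {m : ℕ} {w : Word m} {α : ℕ → ℕ} :
    w.HasWeight α ↔ ∀ i, (w.block i).card = α i := Iff.rfl

theorem Word.count_mono {m : ℕ} (w : Word m) {k k' : ℕ} (h : k ≤ k') (i : ℕ) :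
    w.count k i ≤ w.count k' i := by
  refine Finset.card_le_card fun j => ?_
  simp only [Finset.mem_filter, Finset.mem_univ, true_and]
  exact fun hj => ⟨hj.1.trans_le h, hj.2⟩

theorem Word.count_zero {m : ℕ} (w : Word m) (i : ℕ) : w.count 0 i = 0 := by
  simp [Word.count]

theorem Word.count_succ {m : ℕ} (w : Word m) (j : Fin m) (i : ℕ) :
    w.count (j + 1) i = w.count j i + if w j = i then 1 else 0 := by
  unfold Word.count
  have : (Finset.univ.filter fun k : Fin m => (k : ℕ) < j + 1 ∧ w k = i) =
      (Finset.univ.filter fun k : Fin m => (k : ℕ) < j ∧ w k = i) ∪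
        if w j = i then {j} else ∅ := by
    ext k
    by_cases hk : k = j
    · subst hk; split_ifs with h <;> simp [h]
    · have : (k : ℕ) ≠ j := fun e => hk (Fin.ext e)
      split_ifs with h
      · simp [hk]; intro _; omega
      · simp; intro _; omega
  rw [this, Finset.card_union_of_disjoint]
  · split_ifs <;> simp
  · split_ifs <;> simp

theorem Word.count_congr {m : ℕ} {w w' : Word m} {k : ℕ} (h : ∀ j : Fin m, (j : ℕ) < k → w j = w' j)
    (i : ℕ) : w.count k i = w'.count k i := by
  unfold Word.count
  congr 1
  ext j
  simp only [Finset.mem_filter, Finset.mem_univ, true_and]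
  exact ⟨fun hj => ⟨hj.1, h j hj.1 ▸ hj.2⟩, fun hj => ⟨hj.1, (h j hj.1).symm ▸ hj.2⟩⟩

theorem Word.IsLattice.count_antitone {m : ℕ} {w : Word m} (h : w.IsLattice) (k : ℕ) :
    Antitone (w.count k) := antitone_nat_of_succ_le (h k)

/-- The conjugate word: the `j`-th letter is the number of earlier occurrences of `t j`. On lattice
words this is the transposition of standard tableaux. -/
def Word.conj {m : ℕ} (t : Word m) : Word m := fun j => t.count j (t j)

theorem Word.exists_conj_eq {m : ℕ} (t : Word m) {k i a : ℕ} (hk : k ≤ m) (h : i < t.count k a) :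
    ∃ j : Fin m, (j : ℕ) < k ∧ t j = a ∧ t.conj j = i := by
  induction k with
  | zero => simp [Word.count_zero] at h
  | succ k ih =>
    by_cases hi : i < t.count k a
    · obtain ⟨j, hj, h1⟩ := ih (by omega) hi
      exact ⟨j, by omega, h1⟩
    · have := t.count_succ ⟨k, hk⟩ a
      simp only at this
      rw [this] at h
      split_ifs at h with hc
      · refine ⟨⟨k, hk⟩, by simp, hc, ?_⟩
        rw [Word.conj, hc]
        simp only
        omega
      · omega

theorem Word.conj_injOn {m : ℕ} (t : Word m) {j j' : Fin m} (h : t j = t j')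
    (hc : t.conj j = t.conj j') : j = j' := by
  wlog hlt : j < j' generalizing j j'
  · rcases lt_trichotomy j j' with hl | rfl | hl
    · exact this h hc hl
    · rfl
    · exact (this h.symm hc.symm hl).symm
  have h1 := t.count_succ j (t j)
  have h2 := t.count_mono (k := j + 1) (k' := j') (by exact hlt) (t j)
  simp only [Word.conj, ← h] at hc
  simp only [if_true] at h1
  omega

/-- The letter i appears in the conjugate word exactly once for each letter a of t, namely at the
(i+1)-st occurrence of a. Thus the weights of prefixes of the conjugate word are the conjugates of
those of t. -/
theorem Word.count_conj {m : ℕ} (t : Word m) {k : ℕ} (hk : k ≤ m) (i : ℕ) :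
    t.conj.count k i = ((Finset.univ.image t).filter fun a => i < t.count k a).card := by
  unfold Word.count
  refine Finset.card_bij (fun j _ => t j) ?_ ?_ ?_
  · intro j hj
    simp only [Finset.mem_filter, Finset.mem_univ, true_and] at hj
    simp only [Finset.mem_filter, Finset.mem_image, Finset.mem_univ, true_and,
      exists_apply_eq_apply, ← hj.2]
    have h1 := t.count_succ j (t j)
    have h2 := t.count_mono (k := j + 1) (k' := k) hj.1 (t j)
    simp only [if_true] at h1
    change t.conj j < t.count k (t j)
    rw [Word.conj]
    omega
  · intro j hj j' hj' h
    simp only [Finset.mem_filter, Finset.mem_univ, true_and] at hj hj'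
    exact t.conj_injOn h (hj.2.trans hj'.2.symm)
  · intro a ha
    obtain ⟨j, h1, h2, h3⟩ := t.exists_conj_eq hk (Finset.mem_filter.1 ha).2
    exact ⟨j, by simp [h1, h3], h2⟩

theorem Word.isLattice_conj {m : ℕ} (t : Word m) : t.conj.IsLattice := by
  rw [Word.isLattice_iff]
  intro k i
  have key : ∀ k ≤ m, t.conj.count k (i + 1) ≤ t.conj.count k i := fun k hk => by
    rw [t.count_conj hk, t.count_conj hk]
    refine Finset.card_le_card fun a => ?_
    simp only [Finset.mem_filter]
    exact fun h => ⟨h.1, by omega⟩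
  rcases le_total k m with hk | hk
  · exact key k hk
  · have := key m le_rfl
    rwa [Word.count_of_le _ le_rfl, Word.count_of_le _ le_rfl, ← Word.count_of_le _ hk,
      ← Word.count_of_le _ hk] at this

theorem Word.IsLattice.conj_conj {m : ℕ} {t : Word m} (h : t.IsLattice) : t.conj.conj = t := by
  funext j
  rw [Word.conj, Word.count_conj _ j.2.le]
  have : ((Finset.univ.image t).filter fun a => t.conj j < t.count j a) = Finset.range (t j) := by
    have key : ∀ a, t.conj j < t.count j a ↔ a < t j := by
      intro a
      constructor
      · intro ha
        by_contra hle
        have := h.count_antitone j (not_lt.1 hle)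
        rw [Word.conj] at ha
        omega
      · intro ha
        have h1 := h.count_antitone (j + 1) ha.le
        rw [t.count_succ j, t.count_succ j, if_pos rfl, if_neg ha.ne'] at h1
        rw [Word.conj]
        omega
    ext a
    simp only [Finset.mem_filter, Finset.mem_range, key, and_iff_right_iff_imp]
    intro ha
    obtain ⟨p, -, hp, -⟩ := t.exists_conj_eq j.2.le ((key a).2 ha)
    exact Finset.mem_image.2 ⟨p, Finset.mem_univ _, hp⟩
  rw [this, Finset.card_range]

theorem card_filter_lt_rowLen {m : ℕ} {t : Word m} {μ : YoungDiagram}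
    (h : t.HasWeight fun i => μ.rowLen i) (i : ℕ) :
    ((Finset.univ.image t).filter fun a => i < (t.block a).card).card = μ.transpose.rowLen i := by
  rw [Word.hasWeight_iff] at h
  have : ((Finset.univ.image t).filter fun a => i < (t.block a).card) =
      Finset.range (μ.transpose.rowLen i) := by
    ext a
    simp only [Finset.mem_filter, Finset.mem_range, h, YoungDiagram.rowLen_transpose,
      ← YoungDiagram.mem_iff_lt_rowLen, ← YoungDiagram.mem_iff_lt_colLen, and_iff_right_iff_imp]
    intro ha
    have h0 : 0 < (t.block a).card := by
      rw [h]; exact (Nat.zero_le i).trans_lt (YoungDiagram.mem_iff_lt_rowLen.1 ha)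
    obtain ⟨j, hj⟩ := Finset.card_pos.1 h0
    exact Finset.mem_image.2 ⟨j, Finset.mem_univ _, Word.mem_block.1 hj⟩
  rw [this, Finset.card_range]

theorem Word.HasWeight.conj {m : ℕ} {t : Word m} {μ : YoungDiagram}
    (h : t.HasWeight fun i => μ.rowLen i) : t.conj.HasWeight fun i => μ.transpose.rowLen i := by
  rw [Word.hasWeight_iff]
  intro i
  rw [← Word.count_of_le _ le_rfl, Word.count_conj _ le_rfl, ← card_filter_lt_rowLen h]
  simp only [Word.count_of_le _ le_rfl]

/-- A nonzero sign forces x to run through 0, …, k-1 on each block of size k. So the letter i occurs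
once for every block longer than i, which counts a column of μ. -/
theorem hasWeight_of_wordSgn_ne_zero {m : ℕ} {t x : Word m} {μ : YoungDiagram}
    (h : t.HasWeight fun i => μ.rowLen i) (hx : wordSgn t x ≠ 0) :
    x.HasWeight fun i => μ.transpose.rowLen i := by
  rw [Word.hasWeight_iff]
  intro i
  rw [← card_filter_lt_rowLen h]
  refine Finset.card_bij (fun j _ => t j) ?_ ?_ ?_
  · intro j hj
    rw [Word.mem_block] at hj
    simp only [Finset.mem_filter, Finset.mem_image, Finset.mem_univ, true_and,
      exists_apply_eq_apply, ← hj]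
    exact lt_card_block_of_wordSgn_ne_zero hx j
  · intro j hj j' hj' e
    rw [Word.mem_block] at hj hj'
    exact eq_of_wordSgn_ne_zero hx e (hj.trans hj'.symm)
  · intro a ha
    obtain ⟨p, hp, hp'⟩ := exists_of_lt_card_block hx (Finset.mem_filter.1 ha).2
    exact ⟨p, Word.mem_block.2 hp', hp⟩

/-- On each block of t the conjugate word reads 0, 1, 2, … in order. -/
theorem wordSgn_conj {m : ℕ} (t : Word m) : wordSgn t t.conj = 1 := by
  rw [wordSgn_eq_prod_blockSgn]
  refine Finset.prod_eq_one fun i _ => ?_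
  rw [blockSgn, ← seqSign_val (t.block i).card]
  congr 1
  funext r
  have hr := Word.mem_block.1 ((t.block i).orderEmbOfFin_mem rfl r)
  rw [Word.conj, hr, Word.count, ← Fin.card_Iio r]
  symm
  refine Finset.card_bij (fun s _ => (t.block i).orderEmbOfFin rfl s) ?_ ?_ ?_
  · intro s hs
    have h2 := Word.mem_block.1 ((t.block i).orderEmbOfFin_mem rfl s)
    have h3 : (t.block i).orderEmbOfFin rfl s < (t.block i).orderEmbOfFin rfl r :=
      (OrderEmbedding.lt_iff_lt _).2 (Finset.mem_Iio.1 hs)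
    simpa [h2] using h3
  · intro s _ s' _ e
    exact (RelEmbedding.injective _) e
  · intro j hj
    simp only [Finset.mem_filter, Finset.mem_univ, true_and] at hj
    obtain ⟨hj, rfl⟩ := hj
    obtain ⟨s, hs⟩ := exists_orderEmb_block t j
    refine ⟨s, Finset.mem_Iio.2 ?_, hs⟩
    rw [← (OrderEmbedding.lt_iff_lt ((t.block (t j)).orderEmbOfFin rfl)), hs]
    exact hj

/-- At the first position j where the words differ, suppose t j < s j. The lattice property of s
gives more letters t j than s j before j, so t has an earlier occurrence p of t j whose conjugate
letter is that of s at j. Since s and t agree before j, the conjugate of s repeats a value at p and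
j inside one block of t, and the sign vanishes. -/
theorem toLex_le_of_wordSgn_conj_ne_zero {m : ℕ} {s t : Word m} (hs : s.IsLattice)
    (h : wordSgn t s.conj ≠ 0) : toLex s ≤ toLex t := by
  by_contra hlt
  rw [not_le] at hlt
  obtain ⟨j, hj, hjlt⟩ := hlt
  simp only [Pi.toLex_apply] at hj hjlt
  have hc : t.count j (t j) = s.count j (t j) := Word.count_congr (fun k hk => hj k hk) _
  have h1 := hs.count_antitone (j + 1) hjlt.le
  rw [s.count_succ, s.count_succ, if_pos rfl, if_neg hjlt.ne'] at h1
  have h2 : s.conj j < t.count j (t j) := by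
    rw [hc, Word.conj]
    omega
  obtain ⟨p, hp, hpt, hpc⟩ := t.exists_conj_eq j.2.le h2
  have h3 : s.conj p = t.conj p := by
    rw [Word.conj, Word.conj, hj p hp]
    exact Word.count_congr (fun k hk => (hj k (hk.trans hp)).symm) _
  have := eq_of_wordSgn_ne_zero h hpt (h3.trans hpc)
  subst this
  exact lt_irrefl _ hp

/-! ### Raising operators on functions on words -/

/-- A word in the letters of `Fin n` as a word. -/
def toWord {m n : ℕ} (x : Fin m → Fin n) : Word m := fun j => (x j : ℕ)

theorem toWord_injective {m n : ℕ} : Function.Injective (toWord (m := m) (n := n)) :=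
  fun _ _ h => funext fun j => Fin.ext (congrFun h j)

/-- The coordinate form of the action of the matrix unit `E_{ab}` on `(ℂⁿ)^{⊗ m}`. -/
def raise {m n : ℕ} (a b : Fin n) (f : (Fin m → Fin n) → ℂ) (y : Fin m → Fin n) : ℂ :=
  ∑ p, if y p = a then f (Function.update y p b) else 0

theorem raise_sub {m n : ℕ} (a b : Fin n) (f g : (Fin m → Fin n) → ℂ) (y : Fin m → Fin n) :
    raise a b (f - g) y = raise a b f y - raise a b g y := by
  simp only [raise, ← Finset.sum_sub_distrib]
  refine Finset.sum_congr rfl fun p _ => ?_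
  split_ifs <;> simp

theorem raise_smul {m n : ℕ} (a b : Fin n) (c : ℂ) (f : (Fin m → Fin n) → ℂ) (y : Fin m → Fin n) :
    raise a b (c • f) y = c * raise a b f y := by
  simp only [raise, Finset.mul_sum]
  refine Finset.sum_congr rfl fun p _ => ?_
  split_ifs <;> simp

theorem sum_raise_mul {m n : ℕ} (a b : Fin n) (f g : (Fin m → Fin n) → ℂ) :
    ∑ y, raise b a f y * g y = ∑ x, f x * raise a b g x := by
  simp only [raise, Finset.sum_mul, Finset.mul_sum, ite_mul, mul_ite, zero_mul, mul_zero]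
  rw [← Finset.sum_product', ← Finset.sum_product', ← Finset.sum_filter, ← Finset.sum_filter]
  refine Finset.sum_bij' (fun z _ => (Function.update z.1 z.2 a, z.2))
    (fun z _ => (Function.update z.1 z.2 b, z.2)) ?_ ?_ ?_ ?_ ?_ <;>
  · rintro ⟨y, p⟩ h
    simp only [Finset.mem_filter] at h
    simp [← h.2]

theorem raise_raise_sub {m n : ℕ} {a b : Fin n} (hab : a ≠ b) (f : (Fin m → Fin n) → ℂ)
    (x : Fin m → Fin n) :
    raise a b (raise b a f) x - raise b a (raise a b f) x =
      (((toWord x).block a).card - ((toWord x).block b).card : ℂ) * f x := by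
  -- The double sum splits by whether both operators act at the same position. Equal positions give
  -- the number of letters a; the remaining part is symmetric in a and b, so it cancels in the
  -- commutator.
  have key : ∀ {a b : Fin n}, a ≠ b → raise a b (raise b a f) x =
      (((toWord x).block a).card : ℂ) * f x + ∑ p, ∑ q, if p ≠ q ∧ x p = a ∧ x q = b then
        f (Function.update (Function.update x p b) q a) else 0 := by
    intro a b hab
    have hc : (((toWord x).block a).card : ℂ) * f x = ∑ p, if x p = a then f x else 0 := by
      rw [← Finset.sum_filter, Finset.sum_const, nsmul_eq_mul]
      congr 3
      ext j
      simp [Word.mem_block, toWord, Fin.ext_iff]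
    rw [hc, ← Finset.sum_add_distrib]
    unfold raise
    refine Finset.sum_congr rfl fun p _ => ?_
    by_cases hp : x p = a
    · simp only [hp, if_true, true_and]
      rw [← Finset.add_sum_erase _ _ (Finset.mem_univ p), Function.update_self, if_pos rfl,
        Function.update_idem, ← hp, Function.update_eq_self,
        ← Finset.add_sum_erase (a := p) _ _ (Finset.mem_univ p)]
      simp only [ne_eq, not_true_eq_false, false_and, if_false, zero_add]
      congr 1
      refine Finset.sum_congr rfl fun q hq => ?_
      have hq := Finset.ne_of_mem_erase hq
      simp [hq, hq.symm]
    · simp [hp]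
  rw [key hab, key hab.symm, Finset.sum_comm]
  have : (∑ q, ∑ p, if p ≠ q ∧ x p = a ∧ x q = b then
        f (Function.update (Function.update x p b) q a) else 0) =
      ∑ p, ∑ q, if p ≠ q ∧ x p = b ∧ x q = a then
        f (Function.update (Function.update x p a) q b) else 0 := by
    refine Finset.sum_congr rfl fun q _ => Finset.sum_congr rfl fun p _ => ?_
    by_cases h : p = q
    · simp [h]
    · rw [Function.update_comm h]
      simp only [ne_eq, h, Ne.symm h, eq_comm, not_false_eq_true, true_and]
      congr 1
      rw [and_comm]
  rw [this]
  ring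

/-- `f` is supported on words of weight `α` and killed by all raising operators. -/
structure IsHW {m n : ℕ} (α : ℕ → ℕ) (f : (Fin m → Fin n) → ℂ) : Prop where
  hasWeight : ∀ x, f x ≠ 0 → (toWord x).HasWeight α
  raise_eq_zero : ∀ a b : Fin n, a < b → ∀ y, raise a b f y = 0

theorem raise_conj {m n : ℕ} (a b : Fin n) (f : (Fin m → Fin n) → ℂ) (y : Fin m → Fin n) :
    raise a b (fun x => starRingEnd ℂ (f x)) y = starRingEnd ℂ (raise a b f y) := by
  simp only [raise, map_sum]
  refine Finset.sum_congr rfl fun p _ => ?_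
  split_ifs <;> simp

/-- Positivity: E_ba is adjoint to E_ab, and E_ab kills f, so the commutator relation yields ‖E_ba
f‖² = (α_a - α_b) ‖f‖². -/
theorem IsHW.weight_le {m n : ℕ} {α : ℕ → ℕ} {f : (Fin m → Fin n) → ℂ} (h : IsHW α f)
    (hf : f ≠ 0) {a b : Fin n} (hab : a < b) : α b ≤ α a := by
  have h1 : ∀ x, raise a b (raise b a f) x = ((α a : ℂ) - α b) * f x := by
    intro x
    have h2 := raise_raise_sub hab.ne f x
    have h3 : raise b a (raise a b f) x = 0 := by
      exact Finset.sum_eq_zero fun p _ => by rw [h.raise_eq_zero a b hab, ite_self]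
    rw [h3, sub_zero] at h2
    rw [h2]
    by_cases hx : f x = 0
    · simp [hx]
    · have := h.hasWeight x hx
      rw [Word.hasWeight_iff] at this
      rw [this, this]
  have h4 := sum_raise_mul a b (fun x => starRingEnd ℂ (f x)) (raise b a f)
  simp only [raise_conj, h1] at h4
  have h5 : (∑ y, Complex.normSq (raise b a f y)) =
      ((α a : ℝ) - α b) * ∑ x, Complex.normSq (f x) := by
    apply Complex.ofReal_injective
    push_cast
    simp only [Complex.normSq_eq_conj_mul_self]
    rw [h4, Finset.mul_sum]
    exact Finset.sum_congr rfl fun x _ => by ring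
  have h6 : 0 < ∑ x, Complex.normSq (f x) := by
    obtain ⟨x, hx⟩ := Function.ne_iff.1 hf
    exact Finset.sum_pos' (fun _ _ => Complex.normSq_nonneg _)
      ⟨x, Finset.mem_univ _, Complex.normSq_pos.2 hx⟩
  have h7 : 0 ≤ ∑ y, Complex.normSq (raise b a f y) :=
    Finset.sum_nonneg fun _ _ => Complex.normSq_nonneg _
  rw [h5] at h7
  have h8 := nonneg_of_mul_nonneg_left h7 h6
  exact_mod_cast sub_nonneg.1 h8

theorem count_toWord_snoc {m n : ℕ} (x : Fin m → Fin n) (a : Fin n) (k i : ℕ) :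
    (toWord (Fin.snoc (α := fun _ => Fin n) x a)).count k i =
      (toWord x).count k i + if m < k ∧ (a : ℕ) = i then 1 else 0 := by
  unfold Word.count
  rw [Finset.card_filter, Finset.card_filter]
  simp only [Fin.sum_univ_castSucc, toWord, Fin.snoc_castSucc,
    Fin.snoc_last, Fin.val_castSucc, Fin.val_last]
  rfl

/-- Induction on the length: among the words in the support take the largest possible last letter a,
and fix it. The slice is again a highest weight vector, so it is nonzero at some lattice word x.
Proper prefixes of xa are then fine by induction, and the full word is fine because the weight is
weakly decreasing. -/
theorem IsHW.exists_lattice {m n : ℕ} {α : ℕ → ℕ} {f : (Fin m → Fin n) → ℂ} (h : IsHW α f)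
    (hf : f ≠ 0) : ∃ x, (toWord x).IsLattice ∧ f x ≠ 0 := by
  induction m generalizing α with
  | zero =>
    obtain ⟨x, hx⟩ := Function.ne_iff.1 hf
    exact ⟨x, by rw [Word.isLattice_iff]; intro k i; simp [Word.count], hx⟩
  | succ m ih =>
    let S : Finset (Fin n) := Finset.univ.filter fun a => ∃ x : Fin m → Fin n,
      f (Fin.snoc (α := fun _ => Fin n) x a) ≠ 0
    have hS : S.Nonempty := by
      obtain ⟨x, hx⟩ := Function.ne_iff.1 hf
      refine ⟨x (Fin.last m), ?_⟩
      simp only [S, Finset.mem_filter, Finset.mem_univ, true_and]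
      exact ⟨fun j => x j.castSucc, by
        have := Fin.snoc_init_self (α := fun _ => Fin n) x
        unfold Fin.init at this
        rwa [this]⟩
    obtain ⟨a, ha, hmax⟩ := S.exists_max_image id hS
    have hzero : ∀ b, a < b → ∀ x : Fin m → Fin n,
        f (Fin.snoc (α := fun _ => Fin n) x b) = 0 := by
      intro b hb x
      by_contra hne
      exact absurd (hmax b (by simpa [S] using ⟨x, hne⟩)) (not_le.2 hb)
    let g : (Fin m → Fin n) → ℂ := fun x => f (Fin.snoc (α := fun _ => Fin n) x a)
    have hg : g ≠ 0 := by
      simp only [S, Finset.mem_filter, Finset.mem_univ, true_and] at ha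
      exact Function.ne_iff.2 ha
    have hW : IsHW (fun i => α i - if (a : ℕ) = i then 1 else 0) g := by
      constructor
      · intro x hx
        have := h.hasWeight _ hx
        rw [Word.hasWeight_iff] at this ⊢
        intro i
        have h2 := count_toWord_snoc x a (m + 1) i
        rw [Word.count_of_le _ le_rfl, Word.count_of_le _ (Nat.le_succ m), this i] at h2
        simp only [Nat.lt_succ_self, true_and] at h2
        omega
      · intro c b hcb y
        have h2 := h.raise_eq_zero c b hcb (Fin.snoc (α := fun _ => Fin n) y a)
        simp only [raise, Fin.sum_univ_castSucc, Fin.snoc_castSucc, Fin.snoc_last,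
          Fin.update_snoc_last, ← Fin.snoc_update] at h2
        -- The term of the raising operator at the last position would turn a into a larger letter
        -- b, where f vanishes by maximality of a.
        have h3 : (if a = c then f (Fin.snoc (α := fun _ => Fin n) y b) else 0) = 0 := by
          split_ifs with hac
          · exact hzero b (hac ▸ hcb) y
          · rfl
        rw [h3, add_zero] at h2
        exact h2
    obtain ⟨x, hx, hgx⟩ := ih hW hg
    refine ⟨Fin.snoc (α := fun _ => Fin n) x a, ?_, hgx⟩
    rw [Word.isLattice_iff] at hx ⊢
    intro k i
    rcases lt_or_ge m k with hk | hk
    · rw [Word.count_of_le _ hk, Word.count_of_le _ hk]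
      have hw := h.hasWeight _ hgx
      rw [Word.hasWeight_iff] at hw
      by_cases hi : i + 1 < n
      · rw [hw, hw]
        exact h.weight_le hf (a := ⟨i, by omega⟩) (b := ⟨i + 1, hi⟩) (by simp [Fin.lt_def])
      · have : (toWord (Fin.snoc (α := fun _ => Fin n) x a)).block (i + 1) = ∅ := by
          rw [Finset.eq_empty_iff_forall_notMem]
          intro j hj
          rw [Word.mem_block] at hj
          have := (Fin.snoc (α := fun _ => Fin n) x a j).2
          simp only [toWord] at hj
          omega
        rw [this]
        simp
    · simp only [count_toWord_snoc, not_lt.2 hk, false_and, if_false, add_zero]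
      exact hx k i

/-! ### The highest weight vectors of a word -/

/-- The coordinates of the highest weight vector of `(ℂⁿ)^{⊗ m}` attached to the word `t`. -/
def wordVec (n : ℕ) {m : ℕ} (t : Word m) : (Fin m → Fin n) → ℂ := fun x => wordSgn t (toWord x)

/-- If y has no repetition inside a block of t, a nonzero term has y ≤ x with x a permutation of 0,
…, k-1 on each block. Then y is one too, the sums over the block agree, and x = y. If y repeats at
p, q in one block, exchanging p and q in x negates the sum, so both sides vanish. -/
theorem sum_upper_mul_wordVec {m n : ℕ} (t : Word m) (u : Matrix (Fin n) (Fin n) ℂ)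
    (h1 : ∀ i, u i i = 1) (h0 : ∀ i j, j < i → u i j = 0) (y : Fin m → Fin n) :
    ∑ x, (∏ j, u (y j) (x j)) * wordVec n t x = wordVec n t y := by
  by_cases hy : ∀ p q, t p = t q → y p = y q → p = q
  · rw [Finset.sum_eq_single y]
    · simp [h1]
    · intro x _ hxy
      by_contra hne
      obtain ⟨hu, hx⟩ := mul_ne_zero_iff.1 hne
      have hx' : wordSgn t (toWord x) ≠ 0 := fun e => hx (by simp [wordVec, e])
      have hle : ∀ j, y j ≤ x j := by
        intro j
        by_contra hlt
        exact (Finset.prod_ne_zero_iff.1 hu) j (Finset.mem_univ _) (h0 _ _ (not_le.1 hlt))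
      have hsum : ∀ i, ∑ j ∈ t.block i, (x j : ℕ) ≤ ∑ j ∈ t.block i, (y j : ℕ) := by
        intro i
        have e1 : ∀ z : Fin m → Fin n, (∀ p q, t p = t q → z p = z q → p = q) →
            (∀ j ∈ t.block i, (z j : ℕ) < (t.block i).card) →
            ∑ j ∈ t.block i, (z j : ℕ) = ∑ c ∈ Finset.range (t.block i).card, c := by
          intro z hz hz'
          have hinj : Set.InjOn (fun j => (z j : ℕ)) (t.block i) := by
            intro p hp q hq e
            rw [Finset.mem_coe, Word.mem_block] at hp hq
            exact hz p q (hp.trans hq.symm) (Fin.ext e)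
          have : (t.block i).image (fun j => (z j : ℕ)) = Finset.range (t.block i).card := by
            apply Finset.eq_of_subset_of_card_le
            · intro c hc
              obtain ⟨j, hj, rfl⟩ := Finset.mem_image.1 hc
              exact Finset.mem_range.2 (hz' j hj)
            · rw [Finset.card_image_of_injOn hinj, Finset.card_range]
          rw [← this, Finset.sum_image hinj]
        have hlt : ∀ j ∈ t.block i, (x j : ℕ) < (t.block i).card := by
          intro j hj
          rw [Word.mem_block] at hj
          rw [← hj]
          exact lt_card_block_of_wordSgn_ne_zero hx' j
        rw [e1 x (fun p q e e' => eq_of_wordSgn_ne_zero hx' e (congrArg Fin.val e')) hlt,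
          e1 y hy fun j hj => lt_of_le_of_lt (hle j) (hlt j hj)]
      refine hxy (funext fun j => Fin.ext ?_)
      have hs := (Finset.sum_eq_sum_iff_of_le (s := t.block (t j)) (f := fun j => (y j : ℕ))
        (g := fun j => (x j : ℕ)) fun i _ => hle i).1
          (le_antisymm (Finset.sum_le_sum fun i _ => hle i) (hsum _))
      exact (hs j (Word.mem_block.2 rfl)).symm
    · simp
  · push Not at hy
    obtain ⟨p, q, ht, hpq, hne⟩ := hy
    have hsw : ∀ z, wordVec n t (z ∘ Equiv.swap p q) = -wordVec n t z := by
      intro z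
      simp only [wordVec]
      rw [← Int.cast_neg, ← wordSgn_comp_swap t (toWord z) hne ht]
      rfl
    have hyy : y ∘ Equiv.swap p q = y := by
      funext j
      rcases eq_or_ne j p with rfl | hj
      · simp [hpq]
      rcases eq_or_ne j q with rfl | hj'
      · simp [hpq]
      simp [Equiv.swap_apply_of_ne_of_ne hj hj']
    have e1 : wordVec n t y = 0 := by
      have := hsw y
      rw [hyy] at this
      exact self_eq_neg.1 this
    rw [e1, ← self_eq_neg, ← Finset.sum_neg_distrib]
    refine Fintype.sum_equiv ((Equiv.swap p q).arrowCongr (Equiv.refl _)) _ _ fun x => ?_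
    have e2 : ((Equiv.swap p q).arrowCongr (Equiv.refl (Fin n))) x = x ∘ Equiv.swap p q := by
      funext j; simp [Equiv.arrowCongr]
    rw [e2, hsw, mul_neg, neg_neg, ← Equiv.prod_comp (Equiv.swap p q)]
    congr 1
    refine Finset.prod_congr rfl fun j _ => ?_
    rw [show y (Equiv.swap p q j) = y j from congrFun hyy j]
    rfl

/-- Differentiate the invariance under 1 + c E_ab at c = 0. -/
theorem raise_eq_zero_of_invariant {m n : ℕ} {f : (Fin m → Fin n) → ℂ}
    (h : ∀ u : Matrix (Fin n) (Fin n) ℂ, (∀ i, u i i = 1) → (∀ i j, j < i → u i j = 0) →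
      ∀ y, ∑ x, (∏ j, u (y j) (x j)) * f x = f y) {a b : Fin n} (hab : a < b)
    (y : Fin m → Fin n) : raise a b f y = 0 := by
  let δ : Fin m → (Fin m → Fin n) → ℂ := fun j x => if y j = x j then 1 else 0
  let e : Fin m → (Fin m → Fin n) → ℂ := fun j x => if y j = a ∧ x j = b then 1 else 0
  have hconst : ∀ c : ℂ, ∑ x, (∏ j, (δ j x + c * e j x)) * f x = f y := by
    intro c
    rw [← h (1 + c • Matrix.single a b 1)]
    · refine Finset.sum_congr rfl fun x _ => ?_
      congr 1
      refine Finset.prod_congr rfl fun j _ => ?_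
      simp only [Matrix.add_apply, Matrix.smul_apply, Matrix.single_apply, Matrix.one_apply,
        smul_eq_mul, δ, e, eq_comm]
    · intro i
      have : ¬ (a = i ∧ b = i) := fun hh => hab.ne (hh.1.trans hh.2.symm)
      simp [this]
    · intro i j hij
      have : ¬ (a = i ∧ b = j) := fun hh => by
        rw [hh.1, hh.2] at hab; exact lt_asymm hab hij
      simp [this, hij.ne']
  have hder : HasDerivAt (fun c : ℂ => ∑ x, (∏ j, (δ j x + c * e j x)) * f x)
      (∑ x, (∑ j, (∏ k ∈ Finset.univ.erase j, (δ k x + 0 * e k x)) • e j x) * f x) 0 := by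
    refine HasDerivAt.fun_sum fun x _ => HasDerivAt.mul_const ?_ _
    refine HasDerivAt.fun_finsetProd fun j _ => ?_
    simpa using ((hasDerivAt_id (0 : ℂ)).mul_const (e j x)).const_add (δ j x)
  simp only [hconst] at hder
  have h0 := hder.unique (hasDerivAt_const (0 : ℂ) (f y))
  rw [← h0]
  simp only [Finset.sum_mul]
  rw [Finset.sum_comm]
  refine Finset.sum_congr rfl fun p _ => ?_
  -- In the p-th term of the product rule, the factors at the other positions force x to agree with
  -- y there, and the differentiated factor forces the letter b at p.
  rw [Finset.sum_eq_single (Function.update y p b)]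
  · rw [Finset.prod_eq_one]
    · simp [e]
    · intro k hk
      simp [δ, Finset.ne_of_mem_erase hk]
  · intro x _ hx
    by_contra hne
    have h1 := left_ne_zero_of_mul hne
    have h2 := left_ne_zero_of_mul (smul_eq_mul (α := ℂ) _ _ ▸ h1)
    have h3 := right_ne_zero_of_mul (smul_eq_mul (α := ℂ) _ _ ▸ h1)
    refine hx (funext fun k => ?_)
    rcases eq_or_ne k p with rfl | hk
    · simp only [e, ne_eq, ite_eq_right_iff, one_ne_zero, imp_false, not_not] at h3
      simp [h3.2]
    · have := Finset.prod_ne_zero_iff.1 h2 k (Finset.mem_erase.2 ⟨hk, Finset.mem_univ _⟩)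
      simp only [δ, zero_mul, add_zero, ne_eq, ite_eq_right_iff, one_ne_zero, imp_false,
        not_not] at this
      simp [hk, this]
  · simp

theorem isHW_wordVec {m : ℕ} (n : ℕ) {t : Word m} {μ : YoungDiagram}
    (h : t.HasWeight fun i => μ.transpose.rowLen i) :
    IsHW (fun i => μ.rowLen i) (wordVec n t) where
  hasWeight x hx := by
    have := hasWeight_of_wordSgn_ne_zero h (x := toWord x) fun e => hx (by simp [wordVec, e])
    rwa [YoungDiagram.transpose_transpose] at this
  raise_eq_zero _ _ hab y := raise_eq_zero_of_invariant
    (fun u h1 h0 y => sum_upper_mul_wordVec t u h1 h0 y) hab y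

theorem IsHW.sub_smul {m n : ℕ} {α : ℕ → ℕ} {f g : (Fin m → Fin n) → ℂ} (hf : IsHW α f)
    (hg : IsHW α g) (c : ℂ) : IsHW α (f - c • g) where
  hasWeight x hx := by
    by_cases h : f x = 0
    · refine hg.hasWeight x fun h' => hx ?_
      simp [h, h']
    · exact hf.hasWeight x h
  raise_eq_zero a b hab y := by
    rw [raise_sub, raise_smul, hf.raise_eq_zero a b hab, hg.raise_eq_zero a b hab, mul_zero,
      sub_zero]

theorem IsHW.mem_span {m n : ℕ} {μ : YoungDiagram} {f : (Fin m → Fin n) → ℂ}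
    (hf : IsHW (fun i => μ.rowLen i) f) :
    f ∈ Submodule.span ℂ (wordVec n '' {t : Word m |
      t.HasWeight (fun i => μ.transpose.rowLen i) ∧ t.IsLattice}) := by
  classical
  have hmax : ∀ g : (Fin m → Fin n) → ℂ, IsHW (fun i => μ.rowLen i) g → g ≠ 0 →
      ∃ x, ((toWord x).IsLattice ∧ g x ≠ 0) ∧ ∀ y, (toWord y).IsLattice ∧ g y ≠ 0 →
        toLex (toWord y).conj ≤ toLex (toWord x).conj := by
    intro g hg hg0
    obtain ⟨x, hx⟩ := hg.exists_lattice hg0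
    obtain ⟨x, hx, hm⟩ := (Finset.univ.filter fun x => (toWord x).IsLattice ∧ g x ≠ 0).exists_max_image
      (fun x => toLex (toWord x).conj) ⟨x, by simpa using hx⟩
    simp only [Finset.mem_filter, Finset.mem_univ, true_and] at hx hm
    exact ⟨x, hx, hm⟩
  -- Well-founded induction on z, the largest conjugate of a lattice word in the support of g.
  -- Subtracting g(x) times the vector of that conjugate word kills the coordinate at x, and by
  -- triangularity adds no larger one.
  have key : ∀ z : Lex (Fin m → ℕ), ∀ g : (Fin m → Fin n) → ℂ, IsHW (fun i => μ.rowLen i) g →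
      ∀ x, (toWord x).IsLattice → g x ≠ 0 → toLex (toWord x).conj = z →
      (∀ y, (toWord y).IsLattice ∧ g y ≠ 0 → toLex (toWord y).conj ≤ z) →
      g ∈ Submodule.span ℂ (wordVec n '' {t : Word m |
        t.HasWeight (fun i => μ.transpose.rowLen i) ∧ t.IsLattice}) := by
    intro z
    induction z using WellFoundedLT.induction with
    | ind z ih =>
      intro g hg x hx hgx hz hle
      have hw : (toWord x).conj.HasWeight fun i => μ.transpose.rowLen i :=
        (hg.hasWeight x hgx).conj
      have hv := isHW_wordVec n hw
      have hvx : wordVec n (toWord x).conj x = 1 := by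
        have := wordSgn_conj (toWord x).conj
        rw [hx.conj_conj] at this
        simp [wordVec, this]
      have hmem : wordVec n (toWord x).conj ∈ Submodule.span ℂ (wordVec n '' {t : Word m |
          t.HasWeight (fun i => μ.transpose.rowLen i) ∧ t.IsLattice}) :=
        Submodule.subset_span ⟨_, ⟨hw, Word.isLattice_conj _⟩, rfl⟩
      rw [← sub_add_cancel g (g x • wordVec n (toWord x).conj)]
      refine Submodule.add_mem _ ?_ (Submodule.smul_mem _ _ hmem)
      have hg' := hg.sub_smul hv (g x)
      by_cases h0 : g - g x • wordVec n (toWord x).conj = 0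
      · rw [h0]; exact Submodule.zero_mem _
      obtain ⟨x', ⟨hx', hgx'⟩, hm⟩ := hmax _ hg' h0
      refine ih _ ?_ _ hg' x' hx' hgx' rfl hm
      have hne : x' ≠ x := by
        rintro rfl
        simp [hvx] at hgx'
      refine lt_of_le_of_ne ?_ ?_
      · by_cases hgz : g x' = 0
        · have hvx' : wordSgn (toWord x).conj (toWord x') ≠ 0 := by
            intro e
            apply hgx'
            simp [hgz, wordVec, e]
          rw [← hz]
          rw [← hx'.conj_conj] at hvx'
          exact toLex_le_of_wordSgn_conj_ne_zero (Word.isLattice_conj _) hvx'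
        · exact hle _ ⟨hx', hgz⟩
      · rw [← hz]
        intro e
        have e' := congrArg Word.conj (toLex.injective e)
        rw [hx'.conj_conj, hx.conj_conj] at e'
        exact hne (toWord_injective e')
  by_cases h0 : f = 0
  · rw [h0]; exact Submodule.zero_mem _
  obtain ⟨x, ⟨hx, hfx⟩, hm⟩ := hmax f hf h0
  exact key _ f hf x hx hfx rfl hm

/-! ### Functions of several words -/

/-- A linear projection P onto K fixes every section of F. Expanding a section in delta functions
and applying P gives the formula with k y = P(δ_y), which does not depend on i. -/
theorem mem_span_sections {W : Type*} {K : Submodule ℂ (W → ℂ)} {ι : Type*} [Fintype W]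
    {F : W → ι → ℂ} (h : ∀ i, (fun w => F w i) ∈ K) :
    ∃ k : W → W → ℂ, (∀ y, k y ∈ K) ∧ ∀ w i, F w i = ∑ y, k y w * F y i := by
  classical
  obtain ⟨P, hP⟩ := LinearMap.exists_leftInverse_of_injective K.subtype K.ker_subtype
  refine ⟨fun y => (P (Pi.single y 1) : W → ℂ), fun y => (P _).2, fun w i => ?_⟩
  have h1 : P (fun w => F w i) = ⟨_, h i⟩ := LinearMap.congr_fun hP ⟨_, h i⟩
  have h2 : (fun w => F w i) = ∑ y, F y i • (Pi.single y 1 : W → ℂ) := by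
    funext w
    simp [Finset.sum_apply, Pi.single_apply]
  have h3 : (P (fun w => F w i) : W → ℂ) w = F w i := congrFun (congrArg Subtype.val h1) w
  rw [h2, map_sum] at h3
  simp only [map_smul, Submodule.coe_sum, Submodule.coe_smul, Finset.sum_apply, Pi.smul_apply,
    smul_eq_mul] at h3
  rw [← h3]
  exact Finset.sum_congr rfl fun y _ => mul_comm _ _

/-- The bilinear map sending `(k, G)` to `X ↦ k (X 0) * G (X 1, …, X d)`. -/
def consMul (W : Type*) (d : ℕ) :
    (W → ℂ) →ₗ[ℂ] ((Fin d → W) → ℂ) →ₗ[ℂ] ((Fin (d + 1) → W) → ℂ) :=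
  LinearMap.mk₂ ℂ (fun k G X => k (X 0) * G (Fin.tail X))
    (fun _ _ _ => funext fun _ => add_mul _ _ _) (fun _ _ _ => funext fun _ => mul_assoc _ _ _)
    (fun _ _ _ => funext fun _ => mul_add _ _ _) fun _ _ _ => funext fun _ => mul_left_comm _ _ _

theorem mem_span_prod {W : Type*} [Fintype W] {d : ℕ} (S : Fin d → Set (W → ℂ))
    (F : (Fin d → W) → ℂ)
    (h : ∀ l X, (fun w => F (Function.update X l w)) ∈ Submodule.span ℂ (S l)) :
    F ∈ Submodule.span ℂ {G : (Fin d → W) → ℂ |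
      ∃ g : Fin d → W → ℂ, (∀ l, g l ∈ S l) ∧ G = fun X => ∏ l, g l (X l)} := by
  induction d with
  | zero =>
    have : F = F default • fun X => ∏ l : Fin 0, (fun _ _ => (0 : ℂ) : Fin 0 → W → ℂ) l (X l) := by
      funext X
      simp [Subsingleton.elim X default]
    rw [this]
    exact Submodule.smul_mem _ _ (Submodule.subset_span ⟨fun _ _ => 0, fun l => l.elim0, rfl⟩)
  | succ d ih =>
    obtain ⟨k, hk, hF⟩ := mem_span_sections (W := W) (ι := Fin d → W)
      (K := Submodule.span ℂ (S 0)) (F := fun w X => F (Fin.cons (α := fun _ => W) w X))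
      fun X => by
        -- A point is needed to fill the frozen slot; if there is none, the space of functions on W
        -- is zero.
        rcases isEmpty_or_nonempty W with hW | ⟨⟨w0⟩⟩
        · rw [Subsingleton.elim (fun w => F (Fin.cons (α := fun _ => W) w X)) 0]
          exact Submodule.zero_mem _
        · simpa using h 0 (Fin.cons (α := fun _ => W) w0 X)
    have hsum : F = ∑ y, consMul W d (k y) fun X => F (Fin.cons (α := fun _ => W) y X) := by
      funext X
      rw [Finset.sum_apply]
      have := hF (X 0) (Fin.tail X)
      rw [Fin.cons_self_tail] at this
      exact this
    rw [hsum]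
    refine Submodule.sum_mem _ fun y _ => ?_
    have hG := ih (fun l => S l.succ) (fun X => F (Fin.cons (α := fun _ => W) y X)) fun l X => by
      simpa [Fin.cons_update] using h l.succ (Fin.cons (α := fun _ => W) y X)
    have := Submodule.apply_mem_map₂ (consMul W d) (hk y) hG
    rw [Submodule.map₂_span_span] at this
    refine Submodule.span_mono ?_ this
    rintro _ ⟨g0, hg0, _, ⟨g, hg, rfl⟩, rfl⟩
    refine ⟨Fin.cons (α := fun _ => W → ℂ) g0 g, fun l => ?_, ?_⟩
    · refine Fin.cases hg0 (fun l => ?_) l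
      simpa using hg l
    · funext X
      simp [Fin.prod_univ_succ, consMul, Fin.tail]

theorem mem_span_tableVec {d m n : ℕ} {lam : Fin d → YoungDiagram}
    {F : (Fin d → Fin m → Fin n) → ℂ}
    (h : ∀ l X, IsHW (fun i => (lam l).rowLen i) fun w => F (Function.update X l w)) :
    F ∈ Submodule.span ℂ ((fun (T : Table d m) X => (tableSgn T (toTable X) : ℂ)) ''
      latticeA d m (weight (conj lam))) := by
  refine Submodule.span_mono ?_ (mem_span_prod _ F fun l X => (h l X).mem_span)
  rintro _ ⟨g, hg, rfl⟩
  choose T hT hTg using hg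
  refine ⟨T, ⟨fun l => (hT l).1, fun l => (hT l).2⟩, ?_⟩
  funext X
  simp only [tableSgn, Int.cast_prod, ← hTg]
  rfl

/-! ### Coordinates on tensor powers -/

/-- The basis `⨂ e_X` of `V^{⊗ m}`. -/
def tensorBasis (d n m : ℕ) : Module.Basis (Fin d → Fin m → Fin n) ℂ (⨂[ℂ]^m (V d n)) :=
  (Basis.piTensorProduct fun _ : Fin m => Basis.piTensorProduct fun _ : Fin d =>
    Pi.basisFun ℂ (Fin n)).reindex (Equiv.piComm fun _ _ => Fin n)

theorem tensorBasis_apply {d n m : ℕ} (X : Fin d → Fin m → Fin n) :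
    tensorBasis d n m X = tensorOf X := by
  simp only [tensorBasis, Module.Basis.reindex_apply, Basis.piTensorProduct_apply,
    Pi.basisFun_apply]
  rfl

/-- The action of `GL(n)^{× d}` on `V^{⊗ m}`. -/
def actPow {d n : ℕ} (m : ℕ) (g : Fin d → GL (Fin n) ℂ) :
    ⨂[ℂ]^m (V d n) →ₗ[ℂ] ⨂[ℂ]^m (V d n) :=
  PiTensorProduct.map fun _ => actV g

theorem repr_actPow_tensorOf {d n m : ℕ} (g : Fin d → GL (Fin n) ℂ) (X Y : Fin d → Fin m → Fin n) :
    (tensorBasis d n m).repr (actPow m g (tensorOf X)) Y =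
      ∏ l, ∏ j, (g l : Matrix (Fin n) (Fin n) ℂ) (Y l j) (X l j) := by
  rw [actPow, tensorOf, PiTensorProduct.map_tprod, tensorBasis, Module.Basis.repr_reindex_apply,
    Basis.piTensorProduct_repr_tprod_apply, Finset.prod_comm]
  refine Finset.prod_congr rfl fun j _ => ?_
  rw [actV, basisVec, PiTensorProduct.map_tprod, Basis.piTensorProduct_repr_tprod_apply]
  refine Finset.prod_congr rfl fun l _ => ?_
  simp

theorem repr_actPow {d n m : ℕ} (g : Fin d → GL (Fin n) ℂ) (v : ⨂[ℂ]^m (V d n))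
    (Y : Fin d → Fin m → Fin n) :
    (tensorBasis d n m).repr (actPow m g v) Y =
      ∑ X, (∏ l, ∏ j, (g l : Matrix (Fin n) (Fin n) ℂ) (Y l j) (X l j)) *
        (tensorBasis d n m).repr v X := by
  conv_lhs => rw [← (tensorBasis d n m).sum_repr v]
  simp only [map_sum, map_smul, tensorBasis_apply, Finsupp.coe_finsetSum, Finset.sum_apply,
    Finsupp.smul_apply, smul_eq_mul, repr_actPow_tensorOf]
  exact Finset.sum_congr rfl fun X _ => mul_comm _ _

theorem repr_actPow_of_isDiag {d n m : ℕ} (t : Fin d → GL (Fin n) ℂ)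
    (ht : ∀ l, (t l : Matrix (Fin n) (Fin n) ℂ).IsDiag) (v : ⨂[ℂ]^m (V d n))
    (Y : Fin d → Fin m → Fin n) :
    (tensorBasis d n m).repr (actPow m t v) Y =
      (∏ l, ∏ j, (t l : Matrix (Fin n) (Fin n) ℂ) (Y l j) (Y l j)) *
        (tensorBasis d n m).repr v Y := by
  rw [repr_actPow, Finset.sum_eq_single Y]
  · intro X _ hX
    obtain ⟨l, hl⟩ := Function.ne_iff.1 hX
    obtain ⟨j, hj⟩ := Function.ne_iff.1 hl
    rw [Finset.prod_eq_zero (Finset.mem_univ l)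
      (Finset.prod_eq_zero (Finset.mem_univ j) (ht l hj.symm)), zero_mul]
  · simp

/-- `v ∈ V^{⊗ m}` has weight `α` under the torus. -/
def HasTorusWeight {d n m : ℕ} (α : Fin d → ℕ → ℕ) (v : ⨂[ℂ]^m (V d n)) : Prop :=
  ∀ t : Fin d → GL (Fin n) ℂ, (∀ l, (t l : Matrix (Fin n) (Fin n) ℂ).IsDiag) →
    actPow m t v = (∏ l, ∏ i : Fin n, (t l : Matrix (Fin n) (Fin n) ℂ) i i ^ α l i) • v

/-- `v ∈ V^{⊗ m}` is fixed by the tuples of upper unitriangular matrices. -/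
def IsUnipotentInvariant {d n m : ℕ} (v : ⨂[ℂ]^m (V d n)) : Prop :=
  ∀ u : Fin d → GL (Fin n) ℂ, (∀ l, (∀ i, (u l : Matrix (Fin n) (Fin n) ℂ) i i = 1) ∧
    ∀ i j, j < i → (u l : Matrix (Fin n) (Fin n) ℂ) i j = 0) → actPow m u v = v

theorem HasTorusWeight.hasWeight {d n m : ℕ} {α : Fin d → ℕ → ℕ} {v : ⨂[ℂ]^m (V d n)}
    (hα : ∀ l i, n ≤ i → α l i = 0) (hv : HasTorusWeight α v) {Y : Fin d → Fin m → Fin n}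
    (hY : (tensorBasis d n m).repr v Y ≠ 0) (l : Fin d) : (toWord (Y l)).HasWeight (α l) := by
  rw [Word.hasWeight_iff]
  intro i
  by_cases hi : i < n
  -- Test with the diagonal matrix having 2 at place i and 1 elsewhere in the l-th factor: the
  -- powers of 2 on both sides determine the number of letters i.
  · let c : Fin n → ℂ := fun k => if k = ⟨i, hi⟩ then 2 else 1
    have hc : (Matrix.diagonal c).det ≠ 0 := by
      rw [Matrix.det_diagonal, Finset.prod_ne_zero_iff]
      intro k _
      simp only [c]
      split_ifs <;> norm_num
    let t : Fin d → GL (Fin n) ℂ :=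
      Function.update 1 l (Matrix.GeneralLinearGroup.mkOfDetNeZero _ hc)
    have htl : (t l : Matrix (Fin n) (Fin n) ℂ) = Matrix.diagonal c := by
      simp only [t, Function.update_self]
      rfl
    have htne : ∀ l', l' ≠ l → (t l' : Matrix (Fin n) (Fin n) ℂ) = 1 := by
      intro l' hl'
      simp [t, hl']
    have hdiag : ∀ l', (t l' : Matrix (Fin n) (Fin n) ℂ).IsDiag := by
      intro l'
      rcases eq_or_ne l' l with rfl | hl'
      · rw [htl]; exact Matrix.isDiag_diagonal _
      · rw [htne l' hl']; exact Matrix.isDiag_one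
    have h2 := congrArg (fun w => (tensorBasis d n m).repr w Y) (hv t hdiag)
    simp only [repr_actPow_of_isDiag t hdiag, map_smul, Finsupp.smul_apply,
      smul_eq_mul] at h2
    have h3 := mul_right_cancel₀ hY h2
    rw [Fintype.prod_eq_single l, Fintype.prod_eq_single l, htl] at h3
    · simp only [Matrix.diagonal_apply_eq] at h3
      rw [Fintype.prod_eq_single (⟨i, hi⟩ : Fin n)] at h3
      · simp only [c, if_true, Finset.prod_ite, Finset.prod_const, one_pow,
          mul_one] at h3
        have h4 : (2 : ℕ) ^ ((Finset.univ.filter fun j => Y l j = ⟨i, hi⟩).card) = 2 ^ α l i := by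
          exact_mod_cast h3
        rw [← Nat.pow_right_injective le_rfl h4]
        congr 1
        ext j
        simp [Word.mem_block, toWord, Fin.ext_iff]
      · intro k hk
        simp [c, hk]
    · intro l' hl'
      simp [htne l' hl']
    · intro l' hl'
      simp [htne l' hl']
  · rw [hα l i (not_lt.1 hi), Finset.card_eq_zero, Finset.eq_empty_iff_forall_notMem]
    intro j hj
    rw [Word.mem_block] at hj
    have := (Y l j).2
    simp only [toWord] at hj
    omega

/-- Take the identity in every factor except the l-th; its matrix entries then keep all other rows
frozen. -/
theorem IsUnipotentInvariant.slice {d n m : ℕ} {v : ⨂[ℂ]^m (V d n)} (hv : IsUnipotentInvariant v)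
    (l : Fin d) (X : Fin d → Fin m → Fin n) (u : Matrix (Fin n) (Fin n) ℂ) (h1 : ∀ i, u i i = 1)
    (h0 : ∀ i j, j < i → u i j = 0) (y : Fin m → Fin n) :
    ∑ x, (∏ j, u (y j) (x j)) * (tensorBasis d n m).repr v (Function.update X l x) =
      (tensorBasis d n m).repr v (Function.update X l y) := by
  have hdet : u.det ≠ 0 := by
    rw [Matrix.det_of_isUpperTriangular (fun i j hij => h0 i j hij)]
    simp [h1]
  let g : Fin d → GL (Fin n) ℂ :=
    Function.update 1 l (Matrix.GeneralLinearGroup.mkOfDetNeZero u hdet)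
  have hgl : (g l : Matrix (Fin n) (Fin n) ℂ) = u := by
    simp only [g, Function.update_self]
    rfl
  have hgne : ∀ l', l' ≠ l → (g l' : Matrix (Fin n) (Fin n) ℂ) = 1 := by
    intro l' hl'
    simp [g, hl']
  have h := congrArg (fun w => (tensorBasis d n m).repr w (Function.update X l y))
    (hv g fun l' => by
      rcases eq_or_ne l' l with rfl | hl'
      · rw [hgl]; exact ⟨h1, h0⟩
      · rw [hgne l' hl']; exact ⟨fun i => Matrix.one_apply_eq i,
          fun i j hij => Matrix.one_apply_ne hij.ne'⟩)
  simp only [repr_actPow] at h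
  rw [← h]
  refine Fintype.sum_of_injective (Function.update X l) (Function.update_injective X l) _ _ ?_ ?_
  · intro Z hZ
    have : ∃ l', l' ≠ l ∧ X l' ≠ Z l' := by
      by_contra hn
      push Not at hn
      refine hZ ⟨Z l, funext fun l' => ?_⟩
      rcases eq_or_ne l' l with rfl | hl'
      · simp
      · simp [hl', hn l' hl']
    obtain ⟨l', hl', hne⟩ := this
    obtain ⟨j, hj⟩ := Function.ne_iff.1 hne
    have hz : (g l' : Matrix (Fin n) (Fin n) ℂ) (Function.update X l y l' j) (Z l' j) = 0 := by
      rw [hgne l' hl', Function.update_of_ne hl']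
      exact Matrix.one_apply_ne hj
    rw [Finset.prod_eq_zero (Finset.mem_univ l') (Finset.prod_eq_zero (Finset.mem_univ j) hz),
      zero_mul]
  · intro x
    congr 1
    rw [Fintype.prod_eq_single l]
    · simp [hgl]
    · intro l' hl'
      simp [hgne l' hl', hl']

theorem isHW_slice {d n m : ℕ} {α : Fin d → ℕ → ℕ} {v : ⨂[ℂ]^m (V d n)}
    (hα : ∀ l i, n ≤ i → α l i = 0) (hw : HasTorusWeight α v) (hu : IsUnipotentInvariant v)
    (l : Fin d) (X : Fin d → Fin m → Fin n) :
    IsHW (α l) fun x => (tensorBasis d n m).repr v (Function.update X l x) where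
  hasWeight x hx := by simpa using hw.hasWeight hα hx l
  raise_eq_zero _ _ hab y := raise_eq_zero_of_invariant (fun u h1 h0 y => hu.slice l X u h1 h0 y)
    hab y

/-! ### The highest weight vectors of a table -/

/-- The highest weight vector `∑_X sgn_T(X) ⨂ e_X` of `V^{⊗ m}`. -/
def tableVec {d m : ℕ} (n : ℕ) (T : Table d m) : ⨂[ℂ]^m (V d n) :=
  ∑ X : Fin d → Fin m → Fin n, (tableSgn T (toTable X) : ℂ) • tensorOf X

theorem repr_tableVec {d n m : ℕ} (T : Table d m) (X : Fin d → Fin m → Fin n) :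
    (tensorBasis d n m).repr (tableVec n T) X = tableSgn T (toTable X) := by
  simp only [tableVec, ← tensorBasis_apply]
  rw [Module.Basis.repr_sum_self]

theorem mem_tablesA_of_tableSgn_ne_zero {d m : ℕ} {lam : Fin d → YoungDiagram} {T X : Table d m}
    (hT : T ∈ tablesA d m (weight (conj lam))) (hX : tableSgn T X ≠ 0) :
    X ∈ tablesA d m (weight lam) := by
  intro l
  have := hasWeight_of_wordSgn_ne_zero (hT l) (Finset.prod_ne_zero_iff.1 hX l (Finset.mem_univ l))
  rwa [conj, YoungDiagram.transpose_transpose] at this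

theorem hasTorusWeight_tableVec {d m : ℕ} (n : ℕ) {lam : Fin d → YoungDiagram} {T : Table d m}
    (hT : T ∈ tablesA d m (weight (conj lam))) :
    HasTorusWeight (weight lam) (tableVec n T) := by
  intro t ht
  refine (tensorBasis d n m).ext_elem fun Y => ?_
  rw [repr_actPow_of_isDiag t ht, map_smul, Finsupp.smul_apply, smul_eq_mul, repr_tableVec]
  by_cases h0 : tableSgn T (toTable Y) = 0
  · simp [h0]
  congr 1
  refine Finset.prod_congr rfl fun l _ => ?_
  have hw := mem_tablesA_of_tableSgn_ne_zero hT h0 l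
  rw [← Finset.prod_fiberwise' Finset.univ (Y l)
    fun i => (t l : Matrix (Fin n) (Fin n) ℂ) i i]
  refine Finset.prod_congr rfl fun i _ => ?_
  rw [Finset.prod_const, ← hw i]
  congr 2
  ext j
  simp only [Finset.mem_filter, Finset.mem_univ, true_and]
  simp [toTable, Fin.ext_iff]

theorem isUnipotentInvariant_tableVec {d m : ℕ} (n : ℕ) (T : Table d m) :
    IsUnipotentInvariant (tableVec n T) := by
  intro u hu
  refine (tensorBasis d n m).ext_elem fun Y => ?_
  rw [repr_actPow]
  simp only [repr_tableVec, tableSgn, Int.cast_prod, ← Finset.prod_mul_distrib]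
  refine Eq.trans ?_ (Finset.prod_congr rfl fun l _ =>
    sum_upper_mul_wordVec (T l) (u l) (hu l).1 (hu l).2 (Y l))
  rw [Finset.prod_univ_sum, Fintype.piFinset_univ]
  rfl

theorem weight_eq_zero {d n : ℕ} {lam : Fin d → YoungDiagram}
    (hlen : ∀ l, (lam l).colLen 0 ≤ n) (l : Fin d) {i : ℕ} (hi : n ≤ i) : weight lam l i = 0 := by
  by_contra h
  have := YoungDiagram.mem_iff_lt_colLen.1 (YoungDiagram.mem_iff_lt_rowLen.2 (Nat.pos_of_ne_zero h))
  have := hlen l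
  omega

theorem mem_span_tableVec_latticeA {d n m : ℕ} {lam : Fin d → YoungDiagram}
    (hlen : ∀ l, (lam l).colLen 0 ≤ n) {v : ⨂[ℂ]^m (V d n)}
    (hw : HasTorusWeight (weight lam) v) (hu : IsUnipotentInvariant v) :
    v ∈ Submodule.span ℂ (tableVec n '' latticeA d m (weight (conj lam))) := by
  have h := mem_span_tableVec fun l X => isHW_slice (fun l _ => weight_eq_zero hlen l) hw hu l X
  let Φ : ((Fin d → Fin m → Fin n) → ℂ) →ₗ[ℂ] ⨂[ℂ]^m (V d n) :=
    (tensorBasis d n m).equivFun.symm.toLinearMap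
  have h2 := Submodule.mem_map_of_mem (f := Φ) h
  rw [Submodule.map_span, ← Set.image_comp] at h2
  have h3 : Φ (fun X => (tensorBasis d n m).repr v X) = v :=
    (tensorBasis d n m).equivFun.symm_apply_apply v
  have h4 : (⇑Φ ∘ fun (T : Table d m) X => (tableSgn T (toTable X) : ℂ)) = tableVec n := by
    funext T
    simp only [Φ, Function.comp, LinearEquiv.coe_coe, Module.Basis.equivFun_symm_apply,
      tensorBasis_apply]
    rfl
  rwa [h4, h3] at h2

/-- Count the letters in row l of any table in the support of v. The bound on the length guarantees
that letters below n account for all cells. -/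
theorem eq_card_of_hasTorusWeight {d n k : ℕ} {lam : Fin d → YoungDiagram}
    (hlen : ∀ l, (lam l).colLen 0 ≤ n) (l : Fin d) {v : ⨂[ℂ]^k (V d n)}
    (hw : HasTorusWeight (weight lam) v) (hv : v ≠ 0) : k = (lam l).card := by
  obtain ⟨Y, hY⟩ : ∃ Y, (tensorBasis d n k).repr v Y ≠ 0 := by
    by_contra hn
    push Not at hn
    exact hv ((tensorBasis d n k).ext_elem fun Y => by simp [hn Y])
  have hwt := hw.hasWeight (fun l _ => weight_eq_zero hlen l) hY l
  have h1 : (Finset.univ : Finset (Fin k)).card = _ := Finset.card_eq_sum_card_fiberwise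
    (f := toWord (Y l)) (t := Finset.range n) fun j _ => by
      simp [toWord]
  have h2 : (lam l).cells.card = _ := Finset.card_eq_sum_card_fiberwise
    (f := Prod.fst) (t := Finset.range n) fun c hc => by
      rw [Finset.mem_coe, YoungDiagram.mem_cells, YoungDiagram.mem_iff_lt_rowLen] at hc
      by_contra hn
      rw [Finset.mem_coe, Finset.mem_range, not_lt] at hn
      have := weight_eq_zero hlen l hn
      rw [weight] at this
      omega
  rw [Finset.card_univ, Fintype.card_fin] at h1
  rw [h1, YoungDiagram.card, h2]
  refine Finset.sum_congr rfl fun i _ => (hwt i).trans ?_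
  exact (lam l).rowLen_eq_card

/-! ### Symmetrizers -/

/-- The operator `∑_ω χ(ω) ω` on `V^{⊗ k}`, for a character `χ` of `S_k`. -/
def symmetrizer (d n k : ℕ) (χ : Equiv.Perm (Fin k) →* ℤˣ) :
    ⨂[ℂ]^k (V d n) →ₗ[ℂ] ⨂[ℂ]^k (V d n) :=
  ∑ ω : Equiv.Perm (Fin k), ((χ ω : ℤ) : ℂ) •
    (PiTensorProduct.reindex ℂ (fun _ => V d n) ω⁻¹).toLinearMap

theorem sym_eq_symmetrizer (d n k : ℕ) : sym d n k = symmetrizer d n k 1 := by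
  simp [sym, symmetrizer]

theorem alt_eq_symmetrizer (d n k : ℕ) : alt d n k = symmetrizer d n k Equiv.Perm.sign := rfl

theorem symmetrizer_apply {d n k : ℕ} (χ : Equiv.Perm (Fin k) →* ℤˣ) (v : ⨂[ℂ]^k (V d n)) :
    symmetrizer d n k χ v = ∑ ω : Equiv.Perm (Fin k), ((χ ω : ℤ) : ℂ) •
      (PiTensorProduct.reindex ℂ (fun _ => V d n) ω⁻¹ v : ⨂[ℂ]^k (V d n)) := by
  simp [symmetrizer]

theorem reindex_inv_tprod {d n k : ℕ} (ω : Equiv.Perm (Fin k)) (f : Fin k → V d n) :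
    (PiTensorProduct.reindex ℂ (fun _ => V d n) ω⁻¹ (PiTensorProduct.tprod ℂ f) :
      ⨂[ℂ]^k (V d n)) = PiTensorProduct.tprod ℂ fun j => f (ω j) :=
  PiTensorProduct.reindex_tprod _ _

theorem symmetrizer_reindex {d n k : ℕ} (χ : Equiv.Perm (Fin k) →* ℤˣ) (π : Equiv.Perm (Fin k))
    (v : ⨂[ℂ]^k (V d n)) :
    symmetrizer d n k χ (PiTensorProduct.reindex ℂ (fun _ => V d n) π⁻¹ v : ⨂[ℂ]^k (V d n)) =
      ((χ π : ℤ) : ℂ) • symmetrizer d n k χ v := by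
  suffices h : symmetrizer d n k χ ∘ₗ
      (PiTensorProduct.reindex ℂ (fun _ => V d n) π⁻¹).toLinearMap =
      ((χ π : ℤ) : ℂ) • symmetrizer d n k χ from LinearMap.congr_fun h v
  refine PiTensorProduct.ext (MultilinearMap.ext fun f => ?_)
  change symmetrizer d n k χ (PiTensorProduct.reindex ℂ (fun _ => V d n) π⁻¹
    (PiTensorProduct.tprod ℂ f) : ⨂[ℂ]^k (V d n)) =
    ((χ π : ℤ) : ℂ) • symmetrizer d n k χ (PiTensorProduct.tprod ℂ f)
  rw [reindex_inv_tprod, symmetrizer_apply, symmetrizer_apply, Finset.smul_sum]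
  symm
  rw [← Equiv.sum_comp (Equiv.mulLeft π)]
  refine Finset.sum_congr rfl fun ω _ => ?_
  rw [reindex_inv_tprod, reindex_inv_tprod, smul_smul]
  congr 1
  rw [Equiv.coe_mulLeft, map_mul, Units.val_mul, Int.cast_mul, ← mul_assoc, ← Int.cast_mul,
    ← Units.val_mul, Int.units_mul_self]
  simp

theorem symmetrizer_symmetrizer {d n k : ℕ} (χ : Equiv.Perm (Fin k) →* ℤˣ)
    (v : ⨂[ℂ]^k (V d n)) : symmetrizer d n k χ (symmetrizer d n k χ v) =
      (k.factorial : ℂ) • symmetrizer d n k χ v := by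
  conv_lhs => rw [symmetrizer_apply χ v]
  simp only [map_sum, map_smul, symmetrizer_reindex, smul_smul, ← Int.cast_mul, ← Units.val_mul,
    Int.units_mul_self, Units.val_one, Int.cast_one, one_smul, Finset.sum_const, Finset.card_univ,
    Fintype.card_perm, Fintype.card_fin, Nat.cast_smul_eq_nsmul]

theorem actPow_symmetrizer {d n k : ℕ} (χ : Equiv.Perm (Fin k) →* ℤˣ) (g : Fin d → GL (Fin n) ℂ)
    (v : ⨂[ℂ]^k (V d n)) :
    actPow k g (symmetrizer d n k χ v) = symmetrizer d n k χ (actPow k g v) := by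
  simp only [symmetrizer_apply, map_sum, map_smul]
  refine Finset.sum_congr rfl fun ω _ => ?_
  congr 1
  exact PiTensorProduct.map_reindex (fun _ => actV g) ω⁻¹ v

theorem symmetrizer_tensorOf_comp {d n m : ℕ} (χ : Equiv.Perm (Fin m) →* ℤˣ)
    (π : Equiv.Perm (Fin m)) (X : Fin d → Fin m → Fin n) :
    symmetrizer d n m χ (tensorOf fun l => X l ∘ π) =
      ((χ π : ℤ) : ℂ) • symmetrizer d n m χ (tensorOf X) := by
  rw [← symmetrizer_reindex]
  exact congrArg _ (reindex_inv_tprod π fun j => basisVec fun l => X l j).symm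

theorem symmetrizer_tableVec_comp {d n m : ℕ} (χ : Equiv.Perm (Fin m) →* ℤˣ)
    (π : Equiv.Perm (Fin m)) (T : Table d m) :
    ∃ ε : ℤˣ, symmetrizer d n m χ (tableVec n fun l => T l ∘ π) =
      ((ε : ℤ) : ℂ) • symmetrizer d n m χ (tableVec n T) := by
  choose ε hε using fun l => exists_unit_wordSgn_comp (T l) π
  refine ⟨(∏ l, ε l) * χ π, ?_⟩
  simp only [tableVec, map_sum, map_smul, Finset.smul_sum, smul_smul]
  symm
  refine Fintype.sum_equiv (Equiv.piCongrRight fun _ : Fin d => π⁻¹.arrowCongr (Equiv.refl (Fin n)))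
    _ _ fun X => ?_
  have hX : (Equiv.piCongrRight fun _ : Fin d => π⁻¹.arrowCongr (Equiv.refl (Fin n))) X =
      fun l => X l ∘ π := by
    funext l j
    simp [Equiv.arrowCongr, Equiv.Perm.inv_def]
  rw [hX, symmetrizer_tensorOf_comp, smul_smul]
  congr 1
  have : tableSgn (fun l => T l ∘ π) (toTable fun l => X l ∘ π) =
      ((∏ l, ε l : ℤˣ) : ℤ) * tableSgn T (toTable X) := by
    rw [tableSgn, tableSgn, Units.coe_prod, ← Finset.prod_mul_distrib]
    exact Finset.prod_congr rfl fun l _ => hε l (toTable X l)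
  rw [this, Units.val_mul]
  push_cast
  ring

theorem eq_zero_of_eq_neg_one_smul {M : Type*} [AddCommMonoid M] [Module ℂ M] {v : M}
    (h : v = (-1 : ℂ) • v) : v = 0 := by
  have h2 : (2 : ℂ) • v = 0 := by
    rw [two_smul]
    nth_rewrite 1 [h]
    nth_rewrite 2 [← one_smul ℂ v]
    rw [← add_smul, neg_add_cancel, zero_smul]
  rw [← one_smul ℂ v, ← inv_mul_cancel₀ (two_ne_zero (α := ℂ)), mul_smul, h2, smul_zero]

/-- Exchange columns p and q in the summation table X. Since p and q share a block in each row of T,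
sgn_T(X) changes by (-1)^d and the symmetrized tensor by χ, so the sum equals its own negative. -/
theorem symmetrizer_tableVec_eq_zero {d n m : ℕ} (χ : Equiv.Perm (Fin m) →* ℤˣ) {T : Table d m}
    {p q : Fin m} (hpq : p ≠ q) (hT : T.col p = T.col q)
    (hχ : ((χ (Equiv.swap p q) : ℤˣ) : ℤ) * (-1) ^ d = -1) :
    symmetrizer d n m χ (tableVec n T) = 0 := by
  refine eq_zero_of_eq_neg_one_smul ?_
  simp only [tableVec, map_sum, map_smul]
  rw [Finset.smul_sum]
  refine Fintype.sum_equiv (Equiv.piCongrRight fun _ : Fin d =>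
    (Equiv.swap p q).arrowCongr (Equiv.refl (Fin n))) _ _ fun X => ?_
  have hX : (Equiv.piCongrRight fun _ : Fin d =>
      (Equiv.swap p q).arrowCongr (Equiv.refl (Fin n))) X = fun l => X l ∘ Equiv.swap p q := by
    funext l j
    simp [Equiv.arrowCongr]
  rw [hX, symmetrizer_tensorOf_comp, smul_smul, smul_smul]
  congr 1
  have : tableSgn T (toTable fun l => X l ∘ Equiv.swap p q) =
      (-1) ^ d * tableSgn T (toTable X) := by
    rw [tableSgn, tableSgn, ← Fin.prod_const d (-1 : ℤ), ← Finset.prod_mul_distrib]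
    refine Finset.prod_congr rfl fun l _ => ?_
    rw [neg_one_mul]
    exact wordSgn_comp_swap (T l) (toTable X l) hpq (congrFun hT l)
  have hχ' : (((χ (Equiv.swap p q) : ℤˣ) : ℤ) : ℂ) * (-1) ^ d = -1 := by exact_mod_cast hχ
  rw [this]
  push_cast
  linear_combination (tableSgn T (toTable X) : ℂ) * hχ'

/-! ### Highest weight vectors in the symmetric and alternating spaces -/

theorem act_lof {d n m : ℕ} (g : Fin d → GL (Fin n) ℂ) (v : ⨂[ℂ]^m (V d n)) :
    act g (DirectSum.lof ℂ ℕ (fun k => ⨂[ℂ]^k (V d n)) m v) =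
      DirectSum.lof ℂ ℕ (fun k => ⨂[ℂ]^k (V d n)) m (actPow m g v) :=
  DirectSum.lmap_lof _ _ _

theorem act_apply {d n : ℕ} (g : Fin d → GL (Fin n) ℂ) (v : TensorSpace d n) (k : ℕ) :
    act g v k = actPow k g (v k) := DirectSum.lmap_apply _ _ _

/-- Common form of all eight statements: any family S serves, provided that each symmetrized lattice
generator is zero or a multiple of one coming from S. -/
theorem HWV_range_symmetrizer {d n m : ℕ} (hd : 0 < d) {lam : Fin d → YoungDiagram}
    (hcard : ∀ l, (lam l).card = m) (hlen : ∀ l, (lam l).colLen 0 ≤ n)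
    (χ : ∀ k, Equiv.Perm (Fin k) →* ℤˣ) {S : Set (Table d m)} {D : Table d m → TensorSpace d n}
    (hS : S ⊆ tablesA d m (weight (conj lam)))
    (hD : ∀ T ∈ S, ∃ c : ℂ, c ≠ 0 ∧ D T = DirectSum.lof ℂ ℕ (fun k => ⨂[ℂ]^k (V d n)) m
      (c • symmetrizer d n m (χ m) (tableVec n T)))
    (hL : ∀ T ∈ latticeA d m (weight (conj lam)), symmetrizer d n m (χ m) (tableVec n T) = 0 ∨
      ∃ T' ∈ S, ∃ c : ℂ, symmetrizer d n m (χ m) (tableVec n T) =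
        c • symmetrizer d n m (χ m) (tableVec n T')) :
    HWV (weight lam) (LinearMap.range (DirectSum.lmap fun k => symmetrizer d n k (χ k))) =
      Submodule.span ℂ (D '' S) := by
  apply le_antisymm
  · rintro v ⟨⟨⟨w, rfl⟩, hw⟩, hu⟩
    set v := DirectSum.lmap (fun k => symmetrizer d n k (χ k)) w with hv
    have hwk : ∀ k, HasTorusWeight (weight lam) (v k) := fun k t ht => by
      have := DFunLike.congr_fun (hw t ht) k
      rwa [act_apply, DirectSum.smul_apply] at this
    have huk : ∀ k, IsUnipotentInvariant (v k) := fun k u h => by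
      have := DFunLike.congr_fun (hu u h) k
      rwa [act_apply] at this
    have hvm : v = DirectSum.lof ℂ ℕ (fun k => ⨂[ℂ]^k (V d n)) m (v m) := by
      refine DFinsupp.ext fun k => ?_
      by_cases hk : k = m
      · subst hk
        exact (DirectSum.lof_apply (M := fun k => ⨂[ℂ]^k (V d n)) ℂ k (v k)).symm
      -- The weight determines the degree, so all components outside degree m vanish; here d > 0
      -- supplies a row in which to count.
      · have h0 : v k = 0 := by
          by_contra hne
          exact hk ((eq_card_of_hasTorusWeight hlen ⟨0, hd⟩ (hwk k) hne).trans (hcard _))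
        rw [h0]
        exact (DirectSum.of_eq_of_ne (β := fun k => ⨂[ℂ]^k (V d n)) m k (v m) hk).symm
    have hsym : v m = ((m.factorial : ℂ)⁻¹) • symmetrizer d n m (χ m) (v m) := by
      have : v m = symmetrizer d n m (χ m) (w m) := DirectSum.lmap_apply _ _ _
      rw [this, symmetrizer_symmetrizer, smul_smul, inv_mul_cancel₀, one_smul]
      exact_mod_cast m.factorial_ne_zero
    have hspan := mem_span_tableVec_latticeA hlen (hwk m) (huk m)
    rw [hvm, hsym, map_smul]
    refine Submodule.smul_mem _ _ ?_
    have h2 := Submodule.mem_map_of_mem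
      (f := DirectSum.lof ℂ ℕ (fun k => ⨂[ℂ]^k (V d n)) m ∘ₗ symmetrizer d n m (χ m)) hspan
    rw [Submodule.map_span, ← Set.image_comp] at h2
    refine Submodule.span_le.2 ?_ h2
    rintro _ ⟨T, hT, rfl⟩
    simp only [Function.comp, LinearMap.comp_apply, SetLike.mem_coe]
    rcases hL T hT with h0 | ⟨T', hT', c, hc⟩
    · rw [h0, map_zero]
      exact Submodule.zero_mem _
    · obtain ⟨c', hc', h⟩ := hD T' hT'
      have : DirectSum.lof ℂ ℕ (fun k => ⨂[ℂ]^k (V d n)) m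
          (symmetrizer d n m (χ m) (tableVec n T)) = (c * c'⁻¹) • D T' := by
        rw [hc, h]
        simp only [LinearMap.map_smul, smul_smul, mul_assoc, inv_mul_cancel₀ hc', mul_one]
      rw [this]
      exact Submodule.smul_mem _ _ (Submodule.subset_span ⟨T', hT', rfl⟩)
  · rw [Submodule.span_le]
    rintro _ ⟨T, hT, rfl⟩
    obtain ⟨c, -, h⟩ := hD T hT
    rw [h, map_smul]
    refine Submodule.smul_mem _ _ ⟨⟨⟨DirectSum.lof ℂ ℕ (fun k => ⨂[ℂ]^k (V d n)) m (tableVec n T),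
      DirectSum.lmap_lof _ _ _⟩, fun t ht => ?_⟩, fun u hu => ?_⟩
    · rw [act_lof, actPow_symmetrizer, hasTorusWeight_tableVec n (hS hT) t ht, map_smul, map_smul]
    · rw [act_lof, actPow_symmetrizer, isUnipotentInvariant_tableVec n T u hu]

/-! ### The generators -/

theorem sign_div_stabCard_ne_zero {d m : ℕ} (T : Table d m) :
    (T.sign : ℂ) / (T.stabCard : ℂ) ≠ 0 := by
  refine div_ne_zero ?_ ?_
  · rw [Int.cast_ne_zero, Table.sign, Finset.prod_ne_zero_iff]
    exact fun l _ => pow_ne_zero _ (by norm_num)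
  · rw [Nat.cast_ne_zero, Table.stabCard]
    have : Nonempty {π : Equiv.Perm (Fin m) // ∀ j, T.col (π j) = T.col j} := ⟨1, fun _ => rfl⟩
    exact Nat.card_pos.ne'

theorem exists_Delta_eq {d n m : ℕ} {lam : Fin d → YoungDiagram} {T : Table d m}
    (hT : T ∈ tablesA d m (weight (conj lam))) :
    ∃ c : ℂ, c ≠ 0 ∧ Delta n lam T = DirectSum.lof ℂ ℕ (fun k => ⨂[ℂ]^k (V d n)) m
      (c • symmetrizer d n m 1 (tableVec n T)) := by
  classical
  refine ⟨_, sign_div_stabCard_ne_zero T, ?_⟩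
  rw [Delta, ← sym_eq_symmetrizer, tableVec, map_sum]
  congr 2
  rw [Finset.sum_filter]
  refine Finset.sum_congr rfl fun X _ => ?_
  rw [map_smul, ite_eq_left_iff]
  intro hX
  rw [not_not.1 (mt (mem_tablesA_of_tableSgn_ne_zero hT) hX), Int.cast_zero, zero_smul]

theorem alt_tensorOf_eq_zero {d n m : ℕ} {X : Fin d → Fin m → Fin n}
    (hX : ¬ Function.Injective (toTable X).col) : alt d n m (tensorOf X) = 0 := by
  simp only [Function.Injective, not_forall] at hX
  obtain ⟨p, q, hc, hpq⟩ := hX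
  have h := symmetrizer_tensorOf_comp Equiv.Perm.sign (Equiv.swap p q) X
  have hXX : (fun l => X l ∘ Equiv.swap p q) = X := by
    funext l j
    have hl : X l p = X l q := Fin.ext (congrFun hc l)
    rcases eq_or_ne j p with rfl | hj
    · simp [hl]
    rcases eq_or_ne j q with rfl | hj'
    · simp [hl]
    simp [Equiv.swap_apply_of_ne_of_ne hj hj']
  rw [hXX, Equiv.Perm.sign_swap hpq] at h
  rw [alt_eq_symmetrizer]
  refine eq_zero_of_eq_neg_one_smul ?_
  simpa using h

/-- The sum over B(λ) may be extended to all tables: outside A(λ) the sign vanishes, and a repeated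
column kills the alternating tensor. -/
theorem exists_Nabla_eq {d n m : ℕ} {lam : Fin d → YoungDiagram} {T : Table d m}
    (hT : T ∈ tablesA d m (weight (conj lam))) :
    ∃ c : ℂ, c ≠ 0 ∧ Nabla n lam T = DirectSum.lof ℂ ℕ (fun k => ⨂[ℂ]^k (V d n)) m
      (c • symmetrizer d n m Equiv.Perm.sign (tableVec n T)) := by
  classical
  refine ⟨_, sign_div_stabCard_ne_zero T, ?_⟩
  rw [Nabla, ← alt_eq_symmetrizer, tableVec, map_sum]
  congr 2
  rw [Finset.sum_filter]
  refine Finset.sum_congr rfl fun X _ => ?_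
  rw [map_smul, ite_eq_left_iff]
  intro hX
  by_cases hi : Function.Injective (toTable X).col
  · rw [not_not.1 (mt (mem_tablesA_of_tableSgn_ne_zero hT) fun h => hX ⟨h, hi⟩), Int.cast_zero,
      zero_smul]
  · rw [alt_tensorOf_eq_zero hi, smul_zero]

/-! ### Lex-tables -/

theorem marginal_eq_card {d m : ℕ} {H : Hypermatrix d} {T : Table d m} (h : IsDLine H T)
    (l : Fin d) (i : ℕ) :
    H.marginal l i = (Finset.univ.filter fun j => T l j = i).card := by
  classical
  rw [Finset.card_eq_sum_card_fiberwise (f := T.col) (t := H.support.filter fun c => c l = i)]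
  · rw [Hypermatrix.marginal, Finsupp.sum, Finset.sum_filter]
    refine Finset.sum_congr rfl fun c _ => ?_
    split_ifs with hc
    · rw [← h.1 c]
      congr 1
      ext j
      simp only [Finset.mem_filter, Finset.mem_univ, true_and]
      exact ⟨fun hj => ⟨(congrFun hj l).trans hc, hj⟩, fun hj => hj.2⟩
    · rfl
  · intro j hj
    simp only [Finset.coe_filter, Finset.mem_univ, true_and, Set.mem_ofPred_eq,
      Finsupp.mem_support_iff] at hj ⊢
    refine ⟨?_, hj⟩
    rw [← h.1]
    exact Finset.card_ne_zero.2 ⟨j, by simp⟩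

theorem lexA_subset_tablesA (d m : ℕ) (α : Fin d → ℕ → ℕ) : lexA d m α ⊆ tablesA d m α := by
  rintro T ⟨H, hH, h⟩ l i
  rw [← marginal_eq_card h, hH]

theorem lexB_subset_lexA (d m : ℕ) (α : Fin d → ℕ → ℕ) : lexB d m α ⊆ lexA d m α :=
  fun _ ⟨H, hH, h⟩ => ⟨H, hH.1, h⟩

/-- The hypermatrix counting the columns of a table. -/
def Table.hypermatrix {d m : ℕ} (T : Table d m) : Hypermatrix d :=
  Finsupp.onFinset (Finset.univ.image T.col)
    (fun i => (Finset.univ.filter fun j => T.col j = i).card) fun i hi => by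
      obtain ⟨j, hj⟩ := Finset.card_ne_zero.1 hi
      exact Finset.mem_image.2 ⟨j, Finset.mem_univ _, (Finset.mem_filter.1 hj).2⟩

theorem isDLine_hypermatrix {d m : ℕ} {T : Table d m} (h : Monotone fun j => toLex (T.col j)) :
    IsDLine T.hypermatrix T := ⟨fun _ => rfl, h⟩

theorem mem_lexA {d m : ℕ} {α : Fin d → ℕ → ℕ} {T : Table d m} (hT : T ∈ tablesA d m α)
    (h : Monotone fun j => toLex (T.col j)) : T ∈ lexA d m α :=
  ⟨T.hypermatrix, fun l i => by rw [marginal_eq_card (isDLine_hypermatrix h), hT l i],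
    isDLine_hypermatrix h⟩

theorem mem_lexB {d m : ℕ} {α : Fin d → ℕ → ℕ} {T : Table d m} (hT : T ∈ tablesB d m α)
    (h : Monotone fun j => toLex (T.col j)) : T ∈ lexB d m α := by
  refine ⟨T.hypermatrix, ⟨fun l i => by
    rw [marginal_eq_card (isDLine_hypermatrix h), hT.1 l i], fun i => ?_⟩, isDLine_hypermatrix h⟩
  rw [← (isDLine_hypermatrix h).1 i]
  refine Finset.card_le_one.2 fun j hj k hk => hT.2 ?_
  rw [(Finset.mem_filter.1 hj).2, (Finset.mem_filter.1 hk).2]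

theorem exists_perm_monotone_col {d m : ℕ} (T : Table d m) :
    ∃ π : Equiv.Perm (Fin m), Monotone fun j => toLex (Table.col (fun l => T l ∘ π) j) :=
  ⟨Tuple.sort fun j => toLex (T.col j), Tuple.monotone_sort fun j => toLex (T.col j)⟩

theorem comp_perm_mem_tablesA {d m : ℕ} {α : Fin d → ℕ → ℕ} {T : Table d m}
    (hT : T ∈ tablesA d m α) (π : Equiv.Perm (Fin m)) : (fun l => T l ∘ π) ∈ tablesA d m α := by
  intro l i
  rw [← hT l i]
  exact Finset.card_bij (fun j _ => π j) (fun j hj => by simpa using hj)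
    (fun _ _ _ _ e => π.injective e) fun j hj => ⟨π⁻¹ j, by simpa using hj, by simp⟩

theorem comp_perm_mem_tablesB {d m : ℕ} {α : Fin d → ℕ → ℕ} {T : Table d m}
    (hT : T ∈ tablesB d m α) (π : Equiv.Perm (Fin m)) : (fun l => T l ∘ π) ∈ tablesB d m α :=
  ⟨comp_perm_mem_tablesA hT.1 π, fun _ _ h => π.injective (hT.2 h)⟩

theorem symmetrizer_tableVec_eq_smul_comp {d n m : ℕ} (χ : Equiv.Perm (Fin m) →* ℤˣ)
    (π : Equiv.Perm (Fin m)) (T : Table d m) :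
    ∃ c : ℂ, symmetrizer d n m χ (tableVec n T) =
      c • symmetrizer d n m χ (tableVec n fun l => T l ∘ π) := by
  obtain ⟨ε, hε⟩ := symmetrizer_tableVec_comp (n := n) χ π T
  refine ⟨((ε : ℤ) : ℂ), ?_⟩
  rw [hε, smul_smul, ← Int.cast_mul, ← Units.val_mul, Int.units_mul_self]
  simp

/-! ### Lattice and lex generators for a general character -/

section Generators

variable {d n m : ℕ} (hd : 0 < d) {lam : Fin d → YoungDiagram} (hcard : ∀ l, (lam l).card = m)
  (hlen : ∀ l, (lam l).colLen 0 ≤ n) (χ : ∀ k, Equiv.Perm (Fin k) →* ℤˣ)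
  {D : Table d m → TensorSpace d n}
  (hD : ∀ T ∈ tablesA d m (weight (conj lam)), ∃ c : ℂ, c ≠ 0 ∧
    D T = DirectSum.lof ℂ ℕ (fun k => ⨂[ℂ]^k (V d n)) m
      (c • symmetrizer d n m (χ m) (tableVec n T)))

include hd hcard hlen hD

theorem HWV_eq_span_latticeA :
    HWV (weight lam) (LinearMap.range (DirectSum.lmap fun k => symmetrizer d n k (χ k))) =
      Submodule.span ℂ (D '' latticeA d m (weight (conj lam))) :=
  HWV_range_symmetrizer hd hcard hlen χ (fun _ h => h.1) (fun T hT => hD T hT.1)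
    fun T hT => Or.inr ⟨T, hT, 1, (one_smul _ _).symm⟩

theorem HWV_eq_span_lexA :
    HWV (weight lam) (LinearMap.range (DirectSum.lmap fun k => symmetrizer d n k (χ k))) =
      Submodule.span ℂ (D '' lexA d m (weight (conj lam))) := by
  refine HWV_range_symmetrizer hd hcard hlen χ (lexA_subset_tablesA _ _ _)
    (fun T hT => hD T (lexA_subset_tablesA _ _ _ hT)) fun T hT => Or.inr ?_
  obtain ⟨π, hπ⟩ := exists_perm_monotone_col T
  exact ⟨_, mem_lexA (comp_perm_mem_tablesA hT.1 π) hπ,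
    symmetrizer_tableVec_eq_smul_comp (χ m) π T⟩

variable (hχ : ∀ p q : Fin m, p ≠ q → ((χ m (Equiv.swap p q) : ℤˣ) : ℤ) * (-1) ^ d = -1)

include hχ

/-- Under `hχ`, generators with a repeated column are zero after symmetrization and can be dropped.
-/
theorem HWV_eq_span_latticeB :
    HWV (weight lam) (LinearMap.range (DirectSum.lmap fun k => symmetrizer d n k (χ k))) =
      Submodule.span ℂ (D '' latticeB d m (weight (conj lam))) := by
  refine HWV_range_symmetrizer hd hcard hlen χ (fun _ h => h.1.1) (fun T hT => hD T hT.1.1)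
    fun T hT => ?_
  by_cases hi : Function.Injective T.col
  · exact Or.inr ⟨T, ⟨⟨hT.1, hi⟩, hT.2⟩, 1, (one_smul _ _).symm⟩
  · simp only [Function.Injective, not_forall] at hi
    obtain ⟨p, q, hc, hpq⟩ := hi
    exact Or.inl (symmetrizer_tableVec_eq_zero (χ m) hpq hc (hχ p q hpq))

theorem HWV_eq_span_lexB :
    HWV (weight lam) (LinearMap.range (DirectSum.lmap fun k => symmetrizer d n k (χ k))) =
      Submodule.span ℂ (D '' lexB d m (weight (conj lam))) := by
  refine HWV_range_symmetrizer hd hcard hlen χ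
    ((lexB_subset_lexA _ _ _).trans (lexA_subset_tablesA _ _ _))
    (fun T hT => hD T (lexA_subset_tablesA _ _ _ (lexB_subset_lexA _ _ _ hT))) fun T hT => ?_
  by_cases hi : Function.Injective T.col
  · obtain ⟨π, hπ⟩ := exists_perm_monotone_col T
    exact Or.inr ⟨_, mem_lexB (comp_perm_mem_tablesB ⟨hT.1, hi⟩ π) hπ,
      symmetrizer_tableVec_eq_smul_comp (χ m) π T⟩
  · simp only [Function.Injective, not_forall] at hi
    obtain ⟨p, q, hc, hpq⟩ := hi
    exact Or.inl (symmetrizer_tableVec_eq_zero (χ m) hpq hc (hχ p q hpq))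

end Generators

theorem symSpace_eq_range (d n : ℕ) :
    symSpace d n = LinearMap.range (DirectSum.lmap fun k => symmetrizer d n k 1) := by
  rw [symSpace]
  congr 2
  exact funext fun k => sym_eq_symmetrizer d n k

end TensorHWV

end

theorem mainTheorem4 (d n m : ℕ) (hd : 0 < d) (lam : Fin d → YoungDiagram)
    (hcard : ∀ l, (lam l).card = m) (hlen : ∀ l, (lam l).colLen 0 ≤ n) :
    -- odd `d`: lattice tables and lex-tables
    (Odd d →
      (TensorHWV.HWV (TensorHWV.weight lam) (TensorHWV.symSpace d n) =
          Submodule.span ℂ (TensorHWV.Delta n lam ''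
            TensorHWV.latticeB d m (TensorHWV.weight (TensorHWV.conj lam))) ∧
        TensorHWV.HWV (TensorHWV.weight lam) (TensorHWV.altSpace d n) =
          Submodule.span ℂ (TensorHWV.Nabla n lam ''
            TensorHWV.latticeA d m (TensorHWV.weight (TensorHWV.conj lam)))) ∧
      (TensorHWV.HWV (TensorHWV.weight lam) (TensorHWV.symSpace d n) =
          Submodule.span ℂ (TensorHWV.Delta n lam ''
            TensorHWV.lexB d m (TensorHWV.weight (TensorHWV.conj lam))) ∧
        TensorHWV.HWV (TensorHWV.weight lam) (TensorHWV.altSpace d n) =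
          Submodule.span ℂ (TensorHWV.Nabla n lam ''
            TensorHWV.lexA d m (TensorHWV.weight (TensorHWV.conj lam))))) ∧
    -- even `d`: lattice tables and lex-tables
    (Even d →
      (TensorHWV.HWV (TensorHWV.weight lam) (TensorHWV.symSpace d n) =
          Submodule.span ℂ (TensorHWV.Delta n lam ''
            TensorHWV.latticeA d m (TensorHWV.weight (TensorHWV.conj lam))) ∧
        TensorHWV.HWV (TensorHWV.weight lam) (TensorHWV.altSpace d n) =
          Submodule.span ℂ (TensorHWV.Nabla n lam ''
            TensorHWV.latticeB d m (TensorHWV.weight (TensorHWV.conj lam)))) ∧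
      (TensorHWV.HWV (TensorHWV.weight lam) (TensorHWV.symSpace d n) =
          Submodule.span ℂ (TensorHWV.Delta n lam ''
            TensorHWV.lexA d m (TensorHWV.weight (TensorHWV.conj lam))) ∧
        TensorHWV.HWV (TensorHWV.weight lam) (TensorHWV.altSpace d n) =
          Submodule.span ℂ (TensorHWV.Nabla n lam ''
            TensorHWV.lexB d m (TensorHWV.weight (TensorHWV.conj lam))))) := by
  have hsym : ∀ T ∈ TensorHWV.tablesA d m (TensorHWV.weight (TensorHWV.conj lam)), _ :=
    fun T hT => TensorHWV.exists_Delta_eq (n := n) hT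
  have halt : ∀ T ∈ TensorHWV.tablesA d m (TensorHWV.weight (TensorHWV.conj lam)), _ :=
    fun T hT => TensorHWV.exists_Nabla_eq (n := n) hT
  rw [TensorHWV.symSpace_eq_range]
  refine ⟨fun h => ?_, fun h => ?_⟩
  · have hχ : ∀ p q : Fin m, p ≠ q →
        (((1 : Equiv.Perm (Fin m) →* ℤˣ) (Equiv.swap p q) : ℤˣ) : ℤ) * (-1) ^ d = -1 :=
      fun p q _ => by simp [h.neg_one_pow]
    exact ⟨⟨TensorHWV.HWV_eq_span_latticeB hd hcard hlen (fun _ => 1) hsym hχ,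
        TensorHWV.HWV_eq_span_latticeA hd hcard hlen (fun _ => Equiv.Perm.sign) halt⟩,
      TensorHWV.HWV_eq_span_lexB hd hcard hlen (fun _ => 1) hsym hχ,
      TensorHWV.HWV_eq_span_lexA hd hcard hlen (fun _ => Equiv.Perm.sign) halt⟩
  · have hχ : ∀ p q : Fin m, p ≠ q →
        ((Equiv.Perm.sign (Equiv.swap p q) : ℤˣ) : ℤ) * (-1) ^ d = -1 :=
      fun p q hpq => by simp [h.neg_one_pow, Equiv.Perm.sign_swap hpq]
    exact ⟨⟨TensorHWV.HWV_eq_span_latticeA hd hcard hlen (fun _ => 1) hsym,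
        TensorHWV.HWV_eq_span_latticeB hd hcard hlen (fun _ => Equiv.Perm.sign) halt hχ⟩,
      TensorHWV.HWV_eq_span_lexA hd hcard hlen (fun _ => 1) hsym,
      TensorHWV.HWV_eq_span_lexB hd hcard hlen (fun _ => Equiv.Perm.sign) halt hχ⟩
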